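/- Let $d\ge 1$, $T>0$, $H_0,H_1,\dots,H_d\in(1/2,1)$, and put $R_H(\xi,\eta)=\tfrac12\big(|\xi|^{2H}+|\eta|^{2H}-|\xi-\eta|^{2H}\big)$ for $\xi,\eta\in\mathbb R$. Let $\rho:\mathbb R^d\to\mathbb R$ be a continuous function of power decay: there are $C$ and $\beta_i\in(0,2)$ with $\beta_i<2H_i$ ($i=1,\dots,d$) such that $0\le\rho(x)\le C\prod_{i=1}^d(1+|x_i|)^{-\beta_i}$ for all $x$. Suppose that $\alpha:=\sum_{i=1}^d(2H_i-\beta_i)<2$. On a probability space let $W=\{W(t,x):t\ge0,\,x\in\mathbb R^d\}$ be a mean-zero Gaussian random field with $\mathbb E[W(t,x)W(s,y)]=R_{H_0}(s,t)\,\rho(x)\rho(y)\prod_{i=1}^dR_{H_i}(x_i,y_i)$, and let $B=\{B_s:0\le s\le T\}$ be a standard $d$-dimensional Brownian motion independent of $W$. Let $\mathcal F^B=\sigma(B_s,0\le s\le T)$. For $\varepsilon,\eta>0$ put $\varphi_\eta=\eta^{-1}\mathbf 1_{[0,\eta]}$, $p_\varepsilon(x)=(2\pi\varepsilon)^{-d/2}e^{-|x|^2/(2\varepsilon)}$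 and $$\dot W_{\varepsilon,\eta}(s,B_s)=\int_0^s\int_{\mathbb R^d}\varphi_\eta(s-r)\,p_\varepsilon(B_s-y)\,W(dr,y)\,dy ,$$ where $\int_0^s\varphi_\eta(s-r)\,W(dr,y)=\eta^{-1}\big(W(s,y)-W(\max(s-\eta,0),y)\big)$ is the Wiener integral of a step function and the integral in $y$ (like the integral in $s$ below) is a Bochner integral in $L^2(\Omega)$. Then for every $t\in[0,T]$ the random variables $V_t^{\varepsilon,\eta}=\int_t^T\dot W_{\varepsilon,\eta}(s,B_s)\,ds$ are well defined elements of $L^2(\Omega)$, and they converge in $L^2(\Omega)$, as $\varepsilon,\eta\downarrow0$ (jointly), to a limit $V_t=:\int_t^TW(ds,B_s)$. Moreover, conditionally on $\mathcal F^B$, $V_t$ is a mean-zero Gaussian random variable with variance $$\mathrm{Var}^W(V_t)=\alpha_{H_0}\int_t^T\!\!\int_t^T|s-s'|^{2H_0-2}\,\rho(B_s)\rho(B_{s'})\prod_{i=1}^dR_{H_i}(B_s^i,B_{s'}^i)\,ds\,ds',\qquad \alpha_{H_0}=H_0(2H_0-1),$$ where the double integral converges absolutely almost surely. -/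

import Mathlib

open MeasureTheory ProbabilityTheory Filter Topology Set

noncomputable section

namespace FracNoise

/-- The covariance `R_H(ξ, η) = (|ξ|^{2H} + |η|^{2H} - |ξ - η|^{2H}) / 2` of a fractional Brownian
motion of Hurst parameter `H`. -/
def fracCov (H ξ η : ℝ) : ℝ :=
  (|ξ| ^ (2 * H) + |η| ^ (2 * H) - |ξ - η| ^ (2 * H)) / 2

/-- The spatial covariance `q(x, y) = ρ(x) ρ(y) ∏ᵢ R_{Hᵢ}(xᵢ, yᵢ)`.  The Hurst parameters are
`H 0` (time) and `H i.succ` (the `i`-th space coordinate). -/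
def spaceCov {d : ℕ} (H : Fin (d + 1) → ℝ) (ρ : EuclideanSpace ℝ (Fin d) → ℝ)
    (x y : EuclideanSpace ℝ (Fin d)) : ℝ :=
  ρ x * ρ y * ∏ i : Fin d, fracCov (H i.succ) (x i) (y i)

/-- `0 ≤ ρ(x) ≤ C ∏ᵢ (1 + |xᵢ|)^{-βᵢ}` for some constant `C`. -/
def PowerDecay {d : ℕ} (ρ : EuclideanSpace ℝ (Fin d) → ℝ) (β : Fin d → ℝ) : Prop :=
  ∃ C : ℝ, ∀ x, 0 ≤ ρ x ∧ ρ x ≤ C * ∏ i : Fin d, (1 + |x i|) ^ (-β i)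

/-- The σ-algebra `F^B = σ(B_s, 0 ≤ s ≤ T)`. -/
abbrev sigmaB {Ω : Type*} {d : ℕ} (T : ℝ) (B : ℝ → Ω → EuclideanSpace ℝ (Fin d)) : MeasurableSpace Ω :=
  ⨆ s : Icc (0 : ℝ) T, MeasurableSpace.comap (B s) inferInstance

/-- The σ-algebra `σ(W(t, x), t ≥ 0, x ∈ ℝ^d)`. -/
abbrev sigmaW {Ω : Type*} {d : ℕ} (W : ℝ → EuclideanSpace ℝ (Fin d) → Ω → ℝ) : MeasurableSpace Ω :=
  ⨆ p : Set.Ici (0 : ℝ) × EuclideanSpace ℝ (Fin d),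
    MeasurableSpace.comap (W p.1 p.2) inferInstance

variable {Ω : Type*} [mΩ : MeasurableSpace Ω]

/-- A weighted fractional Brownian field `W(t, x)`, `t ≥ 0`, `x ∈ ℝ^d`: a mean-zero Gaussian random
field with covariance `R_{H₀}(s, t) q(x, y)`.  The values `W t x` for `t < 0` play no role. -/
structure IsWeightedFracBrownianField {d : ℕ} (H : Fin (d + 1) → ℝ)
    (ρ : EuclideanSpace ℝ (Fin d) → ℝ) (W : ℝ → EuclideanSpace ℝ (Fin d) → Ω → ℝ)
    (P : Measure Ω) : Prop where
  measurable : ∀ t, 0 ≤ t → ∀ x, Measurable (W t x)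
  gaussian : IsGaussianProcess
    (fun p : Set.Ici (0 : ℝ) × EuclideanSpace ℝ (Fin d) => W p.1 p.2) P
  mean : ∀ t, 0 ≤ t → ∀ x, ∫ ω, W t x ω ∂P = 0
  cov : ∀ s t, 0 ≤ s → 0 ≤ t → ∀ x y,
    ∫ ω, W t x ω * W s y ω ∂P = fracCov (H 0) s t * spaceCov H ρ x y

/-- A standard `d`-dimensional Brownian motion on `[0, T]`.  The values `B s` for `s ∉ [0, T]` play
no role. -/
structure IsStdBrownianMotion {d : ℕ} (T : ℝ) (B : ℝ → Ω → EuclideanSpace ℝ (Fin d))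
    (P : Measure Ω) : Prop where
  measurable : ∀ s ∈ Icc 0 T, Measurable (B s)
  zero : ∀ᵐ ω ∂P, B 0 ω = 0
  indep_increments : HasIndepIncrements (fun s : Icc (0 : ℝ) T => B s) P
  law_increments : ∀ s t, 0 ≤ s → s ≤ t → t ≤ T →
    HasLaw (fun ω => B t ω - B s ω)
      (multivariateGaussian 0 ((t - s) • (1 : Matrix (Fin d) (Fin d) ℝ))) P
  continuous_paths : ∀ᵐ ω ∂P, ContinuousOn (fun s => B s ω) (Icc 0 T)

/-- The approximation `φ_η = η⁻¹ 1_{[0, η]}` of the Dirac delta function on the line. -/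
def phi (η t : ℝ) : ℝ := η⁻¹ * (Icc 0 η).indicator (fun _ => (1 : ℝ)) t

/-- On `[0, s]` the function `r ↦ φ_η(s - r)` is `η⁻¹` times the indicator function of the interval
`[max (s - η) 0, s]`. -/
theorem phi_sub_eq {η s r : ℝ} (h0 : 0 ≤ r) (hrs : r ≤ s) :
    phi η (s - r) = η⁻¹ * (Icc (max (s - η) 0) s).indicator (fun _ => (1 : ℝ)) r := by
  unfold phi
  congr 1
  by_cases h : s - η ≤ r
  · rw [indicator_of_mem, indicator_of_mem]
    · exact ⟨max_le h h0, hrs⟩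
    · exact ⟨by linarith, by linarith⟩
  · rw [indicator_of_notMem, indicator_of_notMem]
    · exact fun h' => h (le_trans (le_max_left _ _) h'.1)
    · exact fun h' => h (by linarith [h'.2])

/-- The approximation `p_ε(x) = (2πε)^{-d/2} exp(-|x|² / (2ε))` of the Dirac delta on `ℝ^d`. -/
def heat {d : ℕ} (ε : ℝ) (x : EuclideanSpace ℝ (Fin d)) : ℝ :=
  (2 * Real.pi * ε) ^ (-(d : ℝ) / 2) * Real.exp (-‖x‖ ^ 2 / (2 * ε))

/-- The Wiener integral `∫_0^s φ_η(s - r) W(dr, y)`.  The integrand is a step function in `r`, namely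
`η⁻¹` times the indicator function of `[max (s - η) 0, s]` (see `phi_sub_eq`), and the integral of
the indicator function of an interval `[a, b]` is the increment `W(b, y) - W(a, y)`. -/
def timeIntegral {d : ℕ} (W : ℝ → EuclideanSpace ℝ (Fin d) → Ω → ℝ) (η s : ℝ)
    (y : EuclideanSpace ℝ (Fin d)) (ω : Ω) : ℝ :=
  η⁻¹ * (W s y ω - W (max (s - η) 0) y ω)

/-- The random variable `p_ε(B_s - y) ∫_0^s φ_η(s - r) W(dr, y)`. -/
def noiseDensity {d : ℕ} (W : ℝ → EuclideanSpace ℝ (Fin d) → Ω → ℝ)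
    (B : ℝ → Ω → EuclideanSpace ℝ (Fin d)) (ε η s : ℝ) (y : EuclideanSpace ℝ (Fin d))
    (ω : Ω) : ℝ :=
  heat ε (B s ω - y) * timeIntegral W η s y ω

open Classical in
/-- The class in `L²(Ω)` of a square integrable random variable (and `0` for other functions). -/
def toL2 (P : Measure Ω) (X : Ω → ℝ) : Lp ℝ 2 P :=
  if h : MemLp X 2 P then h.toLp X else 0

/-- The regularized noise
`Ẇ_{ε,η}(s, B_s) = ∫_0^s ∫_{ℝ^d} φ_η(s - r) p_ε(B_s - y) W(dr, y) dy`,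
where the integral in `y` is the Bochner integral of an `L²(Ω)`-valued function.  As for every
stochastic integral, no choice of a version of the random field `W` is involved. -/
def regNoise {d : ℕ} (P : Measure Ω) (W : ℝ → EuclideanSpace ℝ (Fin d) → Ω → ℝ)
    (B : ℝ → Ω → EuclideanSpace ℝ (Fin d)) (ε η s : ℝ) : Lp ℝ 2 P :=
  ∫ y, toL2 P (noiseDensity W B ε η s y)

/-- `V_t^{ε,η} = ∫_t^T Ẇ_{ε,η}(s, B_s) ds`, as a Bochner integral in `L²(Ω)`. -/
def regIntegral {d : ℕ} (P : Measure Ω) (W : ℝ → EuclideanSpace ℝ (Fin d) → Ω → ℝ)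
    (B : ℝ → Ω → EuclideanSpace ℝ (Fin d)) (T t ε η : ℝ) : Lp ℝ 2 P :=
  ∫ s in t..T, regNoise P W B ε η s

/-- The function `|s - s'|^{2H₀-2} ρ(b_s) ρ(b_{s'}) ∏ᵢ R_{Hᵢ}(bᵢ_s, bᵢ_{s'})` of `(s, s')`, for a
path `b`. -/
def varDensity {d : ℕ} (H : Fin (d + 1) → ℝ) (ρ : EuclideanSpace ℝ (Fin d) → ℝ)
    (b : ℝ → EuclideanSpace ℝ (Fin d)) (s s' : ℝ) : ℝ :=
  |s - s'| ^ (2 * H 0 - 2) * spaceCov H ρ (b s) (b s')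

/-- The constant `α_H = H (2H - 1)`, for which `∂²R_H(s, s') / ∂s ∂s' = α_H |s - s'|^{2H-2}` for
`s, s' > 0`, `s ≠ s'`. -/
def alphaH (H : ℝ) : ℝ := H * (2 * H - 1)

/-- The random variance
`α_{H₀} ∫_t^T ∫_t^T |s - s'|^{2H₀-2} ρ(B_s) ρ(B_{s'}) ∏ᵢ R_{Hᵢ}(Bᵢ_s, Bᵢ_{s'}) ds ds'`. -/
def variance {d : ℕ} (H : Fin (d + 1) → ℝ) (ρ : EuclideanSpace ℝ (Fin d) → ℝ)
    (B : ℝ → Ω → EuclideanSpace ℝ (Fin d)) (T t : ℝ) (ω : Ω) : ℝ :=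
  alphaH (H 0) * ∫ s in t..T, ∫ s' in t..T, varDensity H ρ (fun r => B r ω) s s'

/-- Conditionally on the σ-algebra `m`, the random variable `X` is Gaussian with mean `0` and
(random, nonnegative) variance `v`. -/
structure IsCondCenteredGaussian (P : Measure Ω) (m : MeasurableSpace Ω) (X v : Ω → ℝ) : Prop where
  nonneg : ∀ᵐ ω ∂P, 0 ≤ v ω
  law : ∀ A : Set ℝ, MeasurableSet A →
    P⟦X ⁻¹' A | m⟧ =ᵐ[P] fun ω => (gaussianReal 0 (v ω).toNNReal).real A

end FracNoise

end

/-!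
The approximations `V^{ε,η}` are Bochner integrals in `L²(Ω)` of the random variables
`p_ε(B_s - y) ∫ φ_η(s - r) W(dr, y)`.  Independence of `B` and `W` factorizes the covariances of
these random variables on an event `A` of the Brownian motion, so that
`E[1_A V^{ε,η} V^{ε',η'}]` is the integral over `[t, T]²` of the product of two kernels: the
covariance `timeKernel` of the fractional noise mollified in time, and the integral over `A` of the
space covariance `mollCov`, mollified by heat kernels and evaluated at `(B_s, B_{s'})`
(`inner_restrictL2_regIntegral`).  The first converges to `α_{H₀} |s - s'|^{2H₀-2}` and is bounded
by a multiple of it, uniformly in the mollification (`tendsto_timeKernel`, `abs_timeKernel_le`);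
the second converges to the integral over `A` of the space covariance at `(B_s, B_{s'})`, under a
polynomial bound that Gaussian moments integrate.  Dominated convergence and Fubini give
`E[1_A V^{ε,η} V^{ε',η'}] → E[1_A v]`, where `v` is the claimed conditional variance
(`tendsto_inner_restrictL2_regIntegral`).

For `A = Ω` this convergence of inner products is the Cauchy property and yields the limit `V`
(`exists_tendsto_of_tendsto_inner`); for general `A` it identifies the conditional second moment of
`V` as `v`.  Finally, all approximations lie in the closed span of products of values of `W` with
bounded functionals of `B`.  Finite combinations of such products are conditionally centered
Gaussian, which is expressed by conditional characteristic functions, and this property is stable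
under limits in `L²` (`condGaussian_of_mem_closedSpan`).  Uniqueness of characteristic functions on
every event of the Brownian motion then gives the conditional law
(`CondGaussian.isCondCenteredGaussian`).
-/

namespace FracNoise

/-! ### The time covariance of averaged fractional noise -/

/-- Power functions with exponent `b ∈ (-1, 0)` are comparable with their averages, in the form of
an estimate for the increments of the primitive `|z|^b z`. -/
lemma abs_increment_abs_rpow_mul_le {b : ℝ} (hb : -1 < b) (hb0 : b < 0) {z : ℝ} (hz : z ≠ 0)
    (h : ℝ) : |(|z + h| ^ b * (z + h) - |z| ^ b * z)| ≤ 2 * |h| * |z| ^ b := by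
  wlog hz0 : 0 < z generalizing z h with key
  · have hneg : 0 < -z := by
      rcases lt_or_gt_of_ne hz with h' | h'
      · linarith
      · exact absurd h' hz0
    have := key (neg_ne_zero.2 hz) (-h) hneg
    rw [show -z + -h = -(z + h) by ring, abs_neg, abs_neg, abs_neg] at this
    rw [← abs_neg]
    convert this using 2
    ring
  rw [abs_of_pos hz0]
  have hzb : 0 < z ^ b := Real.rpow_pos_of_pos hz0 b
  have hmono : ∀ x y : ℝ, 0 < x → x ≤ y → y ^ b ≤ x ^ b := fun x y hx hxy =>
    Real.rpow_le_rpow_of_nonpos hx hxy hb0.le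
  have hinc : ∀ x y : ℝ, 0 < x → x ≤ y → x ^ b * x ≤ y ^ b * y := fun x y hx hxy => by
    rw [← Real.rpow_add_one hx.ne', ← Real.rpow_add_one (hx.trans_le hxy).ne']
    exact Real.rpow_le_rpow hx.le hxy (by linarith)
  obtain ⟨w, hw⟩ : ∃ w, w = z + h := ⟨_, rfl⟩
  rw [← hw]
  have hh : h = w - z := by linarith
  subst hh
  rcases le_or_gt z w with hzw | hzw
  · have hw0 : 0 < w := hz0.trans_le hzw
    have h1 := hinc z w hz0 hzw
    have h2 := hmono z w hz0 hzw
    rw [abs_of_pos hw0, abs_of_nonneg (by linarith), abs_of_nonneg (by linarith)]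
    nlinarith [mul_nonneg (sub_nonneg.2 h2) hw0.le, mul_nonneg (sub_nonneg.2 hzw) hzb.le]
  rcases lt_trichotomy 0 w with hw0 | rfl | hw0
  · have h1 := hinc w z hw0 hzw.le
    have h2 := hmono w z hw0 hzw.le
    rw [abs_of_pos hw0, abs_sub_comm, abs_of_nonneg (by linarith), abs_sub_comm w,
      abs_of_nonneg (by linarith)]
    nlinarith [mul_nonneg (sub_nonneg.2 h2) hw0.le, mul_nonneg (sub_nonneg.2 hzw.le) hzb.le]
  · simp only [mul_zero, zero_sub, abs_neg]
    rw [abs_of_pos (mul_pos hzb hz0), abs_of_pos hz0]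
    nlinarith [mul_pos hzb hz0]
  · have h1 := hinc (-w) (z - w) (by linarith) (by linarith)
    have h2 := hmono z (z - w) hz0 (by linarith)
    rw [abs_of_neg hw0, abs_sub_comm, abs_sub_comm w, abs_of_pos (show 0 < z - w by linarith),
      abs_of_nonneg]
    · nlinarith [mul_nonneg (sub_nonneg.2 h2) (show 0 ≤ z - w by linarith), mul_pos hzb hz0,
        mul_pos hzb (neg_pos.2 hw0)]
    · have : 0 < (-w) ^ b := Real.rpow_pos_of_pos (by linarith) b
      nlinarith [mul_pos hzb hz0]

lemma hasDerivAt_abs_rpow_mul (b : ℝ) {z : ℝ} (hz : z ≠ 0) :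
    HasDerivAt (fun z : ℝ => |z| ^ b * z) ((b + 1) * |z| ^ b) z := by
  have h1 := ((hasDerivAt_abs hz).rpow_const (p := b) (Or.inl (abs_ne_zero.2 hz))).mul
    (hasDerivAt_id z)
  have h2 : (SignType.sign z : ℝ) * z = |z| := sign_mul_self z
  have h3 : |z| ^ (b - 1) * |z| = |z| ^ b := by
    rw [← Real.rpow_add_one (abs_ne_zero.2 hz)]; ring_nf
  refine h1.congr_deriv ?_
  rw [id, show (SignType.sign z : ℝ) * b * |z| ^ (b - 1) * z + |z| ^ b * 1
    = b * (|z| ^ (b - 1) * ((SignType.sign z : ℝ) * z)) + |z| ^ b by ring, h2, h3]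
  ring

lemma continuous_abs_rpow_mul {b : ℝ} (hb : -1 < b) :
    Continuous (fun z : ℝ => |z| ^ b * z) := by
  have h := fun z : ℝ => (hasDerivAt_abs_rpow z (p := b + 2) (by linarith))
  rw [continuous_iff_continuousAt]
  intro z
  rcases eq_or_ne z 0 with rfl | hz
  · have h1 : Tendsto (fun z : ℝ => |z| ^ (b + 1)) (𝓝 0) (𝓝 0) := by
      have : Continuous fun z : ℝ => |z| ^ (b + 1) :=
        continuous_abs.rpow_const fun _ => Or.inr (by linarith)
      simpa [Real.zero_rpow (show b + 1 ≠ 0 by linarith)] using this.tendsto 0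
    rw [ContinuousAt, mul_zero]
    refine squeeze_zero_norm (fun z => ?_) h1
    rcases eq_or_ne z 0 with rfl | hz
    · simp only [mul_zero, norm_zero]; positivity
    · rw [Real.rpow_add_one (abs_ne_zero.2 hz), norm_mul, Real.norm_eq_abs, Real.norm_eq_abs,
        abs_of_nonneg (by positivity)]
  · exact (hasDerivAt_abs_rpow_mul b hz).continuousAt

/-- The mixed second difference of `|x|^p`, `1 < p < 2`, is bounded by the second derivative
`|x|^(p-2)` at the corner `x`, even when the rectangle contains the singularity. -/
lemma abs_second_difference_le {p : ℝ} (hp : 1 < p) (hp2 : p < 2) {x : ℝ} (hx : x ≠ 0) (h : ℝ)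
    {k : ℝ} (hk : 0 ≤ k) :
    |(|x + k| ^ p - |x + h + k| ^ p - (|x| ^ p - |x + h| ^ p))|
      ≤ 4 * p / (p - 1) * |h| * k * |x| ^ (p - 2) := by
  set G : ℝ → ℝ := fun z => |z| ^ (p - 2) * z with hG
  set φ : ℝ → ℝ := fun r => |x + r| ^ p - |x + h + r| ^ p with hφ
  -- chosen so that `c G` has derivative `2 p |h| |z|^(p-2)`, the bound for the increment of
  -- `p G` over a step `h`
  set c : ℝ := 2 * p * |h| / (p - 1) with hc
  have hc0 : 0 ≤ c := by
    have : 0 < p - 1 := by linarith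
    positivity
  have hφd : ∀ r, HasDerivAt φ (p * G (x + r) - p * G (x + h + r)) r := fun r => by
    have h1 := (hasDerivAt_abs_rpow (x + r) hp).comp_const_add x r
    have h2 := (hasDerivAt_abs_rpow (x + h + r) hp).comp_const_add (x + h) r
    exact (h1.sub h2).congr_deriv (by simp only [hG]; ring)
  have hφb : ∀ r, x + r ≠ 0 → |p * G (x + r) - p * G (x + h + r)|
      ≤ c * ((p - 1) * |x + r| ^ (p - 2)) := fun r hr => by
    have := abs_increment_abs_rpow_mul_le (b := p - 2) (by linarith) (by linarith) hr h
    rw [← mul_sub, abs_mul, abs_of_pos (by linarith : 0 < p), abs_sub_comm,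
      show x + h + r = x + r + h by ring]
    calc _ ≤ p * (2 * |h| * |x + r| ^ (p - 2)) :=
          mul_le_mul_of_nonneg_left this (by linarith)
      _ = _ := by
        rw [hc]; field_simp [show p - 1 ≠ 0 by linarith]
  have hGc : Continuous G := continuous_abs_rpow_mul (by linarith)
  have hφc : Continuous φ := continuous_iff_continuousAt.2 fun r => (hφd r).continuousAt
  -- `c G(x + ·) ± φ` is increasing on both sides of the singularity `-x`
  have hmono : ∀ σ : ℝ, |σ| = 1 → Monotone (fun r => c * G (x + r) + σ * φ r) := by
    intro σ hσ
    have hcont : Continuous (fun r => c * G (x + r) + σ * φ r) := by fun_prop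
    have hder : ∀ r, x + r ≠ 0 → 0 ≤ deriv (fun r => c * G (x + r) + σ * φ r) r := by
      intro r hr
      have h1 : HasDerivAt (fun r => c * G (x + r) + σ * φ r)
          (c * ((p - 2 + 1) * |x + r| ^ (p - 2)) + σ * (p * G (x + r) - p * G (x + h + r))) r :=
        (((hasDerivAt_abs_rpow_mul (p - 2) hr).comp_const_add x r).const_mul c).add
          ((hφd r).const_mul σ)
      rw [h1.deriv]
      have h2 := hφb r hr
      have h3 : |σ * (p * G (x + r) - p * G (x + h + r))| ≤ c * ((p - 1) * |x + r| ^ (p - 2)) := by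
        rw [abs_mul, hσ, one_mul]; exact h2
      have h4 := (abs_le.1 h3).1
      rw [show p - 2 + 1 = p - 1 by ring]
      linarith
    have hdiff : ∀ r, x + r ≠ 0 → DifferentiableAt ℝ (fun r => c * G (x + r) + σ * φ r) r :=
      fun r hr => ((((hasDerivAt_abs_rpow_mul (p - 2) hr).comp_const_add x r).const_mul c).add
          ((hφd r).const_mul σ)).differentiableAt
    refine MonotoneOn.Iic_union_Ici (a := -x) ?_ ?_
    · refine monotoneOn_of_deriv_nonneg (convex_Iic _) hcont.continuousOn ?_ ?_
      · rw [interior_Iic]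
        exact fun r hr => (hdiff r (by have := mem_Iio.1 hr; linarith)).differentiableWithinAt
      · rw [interior_Iic]
        exact fun r hr => hder r (by have := mem_Iio.1 hr; linarith)
    · refine monotoneOn_of_deriv_nonneg (convex_Ici _) hcont.continuousOn ?_ ?_
      · rw [interior_Ici]
        exact fun r hr => (hdiff r (by have := mem_Ioi.1 hr; linarith)).differentiableWithinAt
      · rw [interior_Ici]
        exact fun r hr => hder r (by have := mem_Ioi.1 hr; linarith)
  have h1 := hmono 1 (by simp) hk
  have h2 := hmono (-1) (by simp) hk
  simp only [add_zero] at h1 h2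
  have h3 := abs_increment_abs_rpow_mul_le (b := p - 2) (by linarith) (by linarith) hx k
  rw [abs_of_nonneg hk] at h3
  have h4 : c * (G (x + k) - G x) ≤ c * (2 * k * |x| ^ (p - 2)) :=
    mul_le_mul_of_nonneg_left (le_of_abs_le h3) hc0
  have h5 : c * (2 * k * |x| ^ (p - 2)) = 4 * p / (p - 1) * |h| * k * |x| ^ (p - 2) := by
    rw [hc]; ring
  rw [← h5]
  have h6 : φ 0 = |x| ^ p - |x + h| ^ p := by simp [hφ]
  have h7 : φ k = |x + k| ^ p - |x + h + k| ^ p := rfl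
  rw [← h6, ← h7, abs_le]
  constructor <;> nlinarith

lemma hasDerivAt_abs_rpow_deriv {p : ℝ} {z : ℝ} (hz : z ≠ 0) :
    HasDerivAt (fun z : ℝ => p * |z| ^ (p - 2) * z) (p * (p - 1) * |z| ^ (p - 2)) z := by
  have := ((hasDerivAt_abs_rpow_mul (p - 2) hz).const_mul p).congr_deriv
    (show _ = p * (p - 1) * |z| ^ (p - 2) by ring)
  simpa only [mul_assoc] using this

/-- The mean value theorem, applied in both variables. -/
lemma exists_second_difference_eq {p : ℝ} (hp : 1 < p) {x h k : ℝ} (hh : 0 < h) (hk : 0 < k)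
    (hhk : h + k < |x|) :
    ∃ e, |e - x| ≤ h + k ∧
      |x + k| ^ p - |x - h + k| ^ p - (|x| ^ p - |x - h| ^ p)
        = h * k * (p * (p - 1) * |e| ^ (p - 2)) := by
  obtain ⟨c, hc, hc'⟩ := exists_hasDerivAt_eq_slope
    (fun r : ℝ => |x + r| ^ p - |x - h + r| ^ p)
    (fun r => p * |x + r| ^ (p - 2) * (x + r) - p * |x - h + r| ^ (p - 2) * (x - h + r)) hk
    (by
      refine Continuous.continuousOn ?_
      exact ((by fun_prop : Continuous fun r : ℝ => |x + r|).rpow_const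
        fun _ => Or.inr (by linarith)).sub
        ((by fun_prop : Continuous fun r : ℝ => |x - h + r|).rpow_const
        fun _ => Or.inr (by linarith)))
    (fun r _ => ((hasDerivAt_abs_rpow (x + r) hp).comp_const_add x r).sub
      ((hasDerivAt_abs_rpow (x - h + r) hp).comp_const_add (x - h) r))
  have hne : ∀ z ∈ Icc (x - h + c) (x + c), z ≠ 0 := by
    rintro z ⟨h1, h2⟩ rfl
    have : |x| ≤ h + k := abs_le.2 ⟨by linarith [hc.1, hc.2], by linarith [hc.1, hc.2]⟩
    linarith
  obtain ⟨e, he, he'⟩ := exists_hasDerivAt_eq_slope (fun z : ℝ => p * |z| ^ (p - 2) * z)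
    (fun z => p * (p - 1) * |z| ^ (p - 2)) (show x - h + c < x + c by linarith)
    (fun z hz => (hasDerivAt_abs_rpow_deriv (hne z hz)).continuousAt.continuousWithinAt)
    (fun z hz => hasDerivAt_abs_rpow_deriv (hne z ⟨hz.1.le, hz.2.le⟩))
  refine ⟨e, abs_le.2 ⟨by linarith [he.1, hc.1], by linarith [he.2, hc.2]⟩, ?_⟩
  rw [show x + c - (x - h + c) = h by ring, eq_div_iff hh.ne'] at he'
  rw [← he', sub_zero, eq_div_iff hk.ne', add_zero, add_zero] at hc'
  rw [← hc']
  ring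

lemma tendsto_second_difference {p : ℝ} (hp : 1 < p) {x : ℝ} (hx : x ≠ 0) :
    Tendsto (fun q : ℝ × ℝ => (q.1 * q.2)⁻¹ *
        (|x + q.2| ^ p - |x - q.1 + q.2| ^ p - (|x| ^ p - |x - q.1| ^ p)))
      (𝓝[>] (0 : ℝ) ×ˢ 𝓝[>] (0 : ℝ)) (𝓝 (p * (p - 1) * |x| ^ (p - 2))) := by
  have hcont : ContinuousAt (fun e : ℝ => p * (p - 1) * |e| ^ (p - 2)) x :=
    (continuousAt_const).mul
      (continuous_abs.continuousAt.rpow_const (Or.inl (abs_ne_zero.2 hx)))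
  rw [Metric.tendsto_nhds]
  intro ε hε
  obtain ⟨δ, hδ, hδ'⟩ := Metric.continuousAt_iff.1 hcont ε hε
  have hm : 0 < min δ |x| := lt_min hδ (abs_pos.2 hx)
  have h1 : ∀ᶠ h : ℝ in 𝓝[>] (0 : ℝ), 0 < h ∧ h < min δ |x| / 2 :=
    Filter.Eventually.and self_mem_nhdsWithin
      (nhdsWithin_le_nhds (Iio_mem_nhds (by linarith)))
  filter_upwards [h1.prod_mk h1] with q ⟨⟨hq1, hq1'⟩, hq2, hq2'⟩
  have hlt : q.1 + q.2 < min δ |x| := by linarith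
  obtain ⟨e, he, he'⟩ := exists_second_difference_eq hp hq1 hq2 (hlt.trans_le (min_le_right _ _))
  rw [he', inv_mul_cancel_left₀ (mul_pos hq1 hq2).ne']
  exact hδ' (by rw [Real.dist_eq]; exact he.trans_lt (hlt.trans_le (min_le_left _ _)))

/-- The covariance `(η η')⁻¹ E[(X_s - X_{(s-η)⁺}) (X_{s'} - X_{(s'-η')⁺})]` of the mollified
fractional noise in time. -/
noncomputable def timeKernel (H η η' s s' : ℝ) : ℝ :=
  (η * η')⁻¹ * (fracCov H s s' - fracCov H s (max (s' - η') 0) - fracCov H (max (s - η) 0) s'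
    + fracCov H (max (s - η) 0) (max (s' - η') 0))

lemma timeKernel_eq (H η η' s s' : ℝ) {a a' : ℝ} (ha : a = max (s - η) 0)
    (ha' : a' = max (s' - η') 0) :
    timeKernel H η η' s s' = (η * η')⁻¹ *
      (|s - s' + (s' - a')| ^ (2 * H) - |s - s' - (s - a) + (s' - a')| ^ (2 * H)
        - (|s - s'| ^ (2 * H) - |s - s' - (s - a)| ^ (2 * H))) / 2 := by
  rw [timeKernel, ← ha, ← ha', show s - s' + (s' - a') = s - a' by ring,
    show s - s' - (s - a) + (s' - a') = a - a' by ring, show s - s' - (s - a) = a - s' by ring]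
  unfold fracCov
  ring

/-- The covariance of the mollified noise is dominated, uniformly in the mollification, by the
singular covariance kernel of fractional noise. -/
lemma abs_timeKernel_le {H : ℝ} (hH : H ∈ Ioo (1 / 2 : ℝ) 1) {η η' s s' : ℝ} (hη : 0 < η)
    (hη' : 0 < η') (hs : 0 ≤ s) (hs' : 0 ≤ s') (hne : s ≠ s') :
    |timeKernel H η η' s s'| ≤ 4 * (2 * H) / (2 * H - 1) * |s - s'| ^ (2 * H - 2) := by
  rw [timeKernel_eq H η η' s s' rfl rfl]
  obtain ⟨hH1, hH2⟩ := hH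
  set δ := s - max (s - η) 0 with hδ
  set δ' := s' - max (s' - η') 0 with hδ'
  have hδ0 : 0 ≤ δ := sub_nonneg.2 (max_le (by linarith) hs)
  have hδ0' : 0 ≤ δ' := sub_nonneg.2 (max_le (by linarith) hs')
  have hδη : δ ≤ η := by have := le_max_left (s - η) 0; linarith
  have hδη' : δ' ≤ η' := by have := le_max_left (s' - η') 0; linarith
  have h := abs_second_difference_le (p := 2 * H) (by linarith) (by linarith)
    (sub_ne_zero.2 hne) (-δ) hδ0'
  rw [abs_neg, abs_of_nonneg hδ0, ← sub_eq_add_neg] at h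
  have hK : 0 ≤ 4 * (2 * H) / (2 * H - 1) * |s - s'| ^ (2 * H - 2) :=
    mul_nonneg (div_nonneg (by linarith) (by linarith)) (by positivity)
  have hpos : 0 < η * η' := mul_pos hη hη'
  have hdd : δ * δ' ≤ η * η' := mul_le_mul hδη hδη' hδ0' hη.le
  rw [abs_div, abs_mul, abs_of_pos (inv_pos.2 hpos), abs_two]
  have h2 : (η * η')⁻¹ * |(|s - s' + δ'| ^ (2 * H) - |s - s' - δ + δ'| ^ (2 * H)
      - (|s - s'| ^ (2 * H) - |s - s' - δ| ^ (2 * H)))|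
      ≤ 4 * (2 * H) / (2 * H - 1) * |s - s'| ^ (2 * H - 2) := by
    rw [inv_mul_le_iff₀ hpos]
    calc _ ≤ _ := h
      _ = δ * δ' * (4 * (2 * H) / (2 * H - 1) * |s - s'| ^ (2 * H - 2)) := by ring
      _ ≤ _ := mul_le_mul_of_nonneg_right hdd hK
  linarith

/-- The covariances of the mollified noise converge to the covariance kernel
`α_H |s - s'|^(2H-2)` of fractional noise. -/
lemma tendsto_timeKernel {H : ℝ} (hH : 1 / 2 < H) {s s' : ℝ} (hs : 0 < s)
    (hs' : 0 < s') (hne : s ≠ s') :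
    Tendsto (fun q : ℝ × ℝ => timeKernel H q.1 q.2 s s')
      (𝓝[>] (0 : ℝ) ×ˢ 𝓝[>] (0 : ℝ)) (𝓝 (alphaH H * |s - s'| ^ (2 * H - 2))) := by
  have h := (tendsto_second_difference (p := 2 * H) (by linarith) (sub_ne_zero.2 hne)).div_const 2
  rw [show 2 * H * (2 * H - 1) * |s - s'| ^ (2 * H - 2) / 2 = alphaH H * |s - s'| ^ (2 * H - 2) by
    unfold alphaH; ring] at h
  refine h.congr' ?_
  have h1 : ∀ᶠ q : ℝ × ℝ in 𝓝[>] (0 : ℝ) ×ˢ 𝓝[>] (0 : ℝ), q.1 < s ∧ q.2 < s' :=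
    Filter.Eventually.prod_mk (nhdsWithin_le_nhds (Iio_mem_nhds hs))
      (nhdsWithin_le_nhds (Iio_mem_nhds hs'))
  filter_upwards [h1] with q ⟨hq1, hq2⟩
  rw [timeKernel_eq H q.1 q.2 s s' rfl rfl, max_eq_left (by linarith), max_eq_left (by linarith),
    sub_sub_cancel, sub_sub_cancel]

lemma continuous_fracCov {H : ℝ} (hH : 0 < H) :
    Continuous (fun q : ℝ × ℝ => fracCov H q.1 q.2) := by
  unfold fracCov
  have h2 : 0 < 2 * H := by linarith
  exact ((((continuous_abs.comp continuous_fst).rpow_const fun _ => Or.inr h2.le).add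
    ((continuous_abs.comp continuous_snd).rpow_const fun _ => Or.inr h2.le)).sub
    ((continuous_abs.comp (continuous_fst.sub continuous_snd)).rpow_const
      fun _ => Or.inr h2.le)).div_const 2

lemma continuous_timeKernel {H : ℝ} (hH : 0 < H) (η η' : ℝ) :
    Continuous (fun q : ℝ × ℝ => timeKernel H η η' q.1 q.2) := by
  unfold timeKernel
  have hc := continuous_fracCov hH
  have h1 : Continuous fun q : ℝ × ℝ => max (q.1 - η) 0 := by fun_prop
  have h2 : Continuous fun q : ℝ × ℝ => max (q.2 - η') 0 := by fun_prop
  exact continuous_const.mul (((hc.sub (hc.comp (continuous_fst.prodMk h2))).sub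
    (hc.comp (h1.prodMk continuous_snd))).add (hc.comp (h1.prodMk h2)))

lemma fracCov_comm (H ξ η : ℝ) : fracCov H ξ η = fracCov H η ξ := by
  unfold fracCov; rw [abs_sub_comm, add_comm (|ξ| ^ _)]

/-- The singular kernel `|s - s'|^b`, `b > -1`, is integrable on bounded squares. -/
lemma integrableOn_abs_sub_rpow {b : ℝ} (hb : -1 < b) (t T : ℝ) :
    IntegrableOn (fun p : ℝ × ℝ => |p.1 - p.2| ^ b) (Icc t T ×ˢ Icc t T) := by
  have h1 : IntegrableOn (fun u : ℝ => |u| ^ b) (Icc (t - T) (T - t)) := by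
    have : IntervalIntegrable (fun u : ℝ => |u| ^ b) volume (t - T) (T - t) := by
      refine intervalIntegrable_of_even (fun u => by rw [abs_neg]) fun u hu => ?_
      refine (intervalIntegral.intervalIntegrable_rpow' hb (a := 0) (b := u)).congr_ae ?_
      filter_upwards [ae_restrict_mem measurableSet_uIoc] with x hx
      rw [uIoc_of_le hu.le] at hx
      rw [abs_of_pos hx.1]
    rcases le_or_gt t T with h | h
    · rwa [intervalIntegrable_iff_integrableOn_Icc_of_le (by linarith)] at this
    · rw [Icc_eq_empty (by linarith)]; exact integrableOn_empty
  have h2 : Integrable (fun z : ℝ × ℝ => (Icc t T).indicator (fun _ => (1 : ℝ)) z.1 *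
      (Icc (t - T) (T - t)).indicator (fun u : ℝ => |u| ^ b) z.2) (volume.prod volume) :=
    Integrable.mul_prod ((integrable_indicator_iff measurableSet_Icc).2
      (integrableOn_const (by simp))) ((integrable_indicator_iff measurableSet_Icc).2 h1)
  have h3 := ((measurePreserving_prod_sub (volume : Measure ℝ) (volume : Measure ℝ)).integrable_comp
    h2.aestronglyMeasurable).2 h2
  refine (h3.integrableOn (s := Icc t T ×ˢ Icc t T)).congr ?_
  filter_upwards [ae_restrict_mem (measurableSet_Icc.prod measurableSet_Icc)] with p hp
  have hp1 := hp.1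
  have hp2 := hp.2
  simp only [Function.comp]
  rw [indicator_of_mem hp1, indicator_of_mem, one_mul, abs_sub_comm]
  exact ⟨by linarith [hp1.2, hp2.1], by linarith [hp1.1, hp2.2]⟩

/-! ### Heat kernels and the mollified space covariance -/

section

variable {d : ℕ}

lemma heat_nonneg {ε : ℝ} (hε : 0 < ε) (x : EuclideanSpace ℝ (Fin d)) : 0 ≤ heat ε x := by
  unfold heat; positivity

lemma heat_le {ε : ℝ} (hε : 0 < ε) (x : EuclideanSpace ℝ (Fin d)) :
    heat ε x ≤ (2 * Real.pi * ε) ^ (-(d : ℝ) / 2) := by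
  refine mul_le_of_le_one_right (by positivity) (Real.exp_le_one_iff.2 ?_)
  rw [neg_div]
  exact neg_nonpos.2 (by positivity)

lemma continuous_heat (ε : ℝ) : Continuous (heat ε : EuclideanSpace ℝ (Fin d) → ℝ) := by
  unfold heat; fun_prop

/-- Heat kernels decay faster than any power. -/
lemma exists_heat_le (N : ℕ) {ε : ℝ} (hε : 0 < ε) :
    ∃ C, 0 ≤ C ∧ ∀ x : EuclideanSpace ℝ (Fin d), heat ε x ≤ C * ((1 + ‖x‖) ^ N)⁻¹ := by
  refine ⟨(2 * Real.pi * ε) ^ (-(d : ℝ) / 2) * (N.factorial * Real.exp (1 + ε / 2)),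
    by positivity, fun x => ?_⟩
  rw [heat, mul_assoc ((2 * Real.pi * ε) ^ (-(d : ℝ) / 2))]
  refine mul_le_mul_of_nonneg_left ?_ (by positivity)
  have hpos : 0 < (1 + ‖x‖) ^ N := by positivity
  rw [← div_eq_mul_inv, le_div_iff₀ hpos]
  have h1 := Real.pow_div_factorial_le_exp (1 + ‖x‖) (by positivity) N
  rw [div_le_iff₀ (by positivity)] at h1
  calc _ ≤ Real.exp (-‖x‖ ^ 2 / (2 * ε)) * (Real.exp (1 + ‖x‖) * N.factorial) :=
        mul_le_mul_of_nonneg_left h1 (by positivity)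
    _ = N.factorial * Real.exp (-‖x‖ ^ 2 / (2 * ε) + (1 + ‖x‖)) := by
      rw [Real.exp_add (-‖x‖ ^ 2 / (2 * ε))]; ring
    _ ≤ _ := by
      refine mul_le_mul_of_nonneg_left (Real.exp_le_exp.2 ?_) (by positivity)
      have : -‖x‖ ^ 2 / (2 * ε) + (1 + ‖x‖) = 1 + ε / 2 - (‖x‖ - ε) ^ 2 / (2 * ε) := by
        field_simp; ring
      rw [this]
      have : 0 ≤ (‖x‖ - ε) ^ 2 / (2 * ε) := by positivity
      linarith

lemma exists_heat_sub_le (N : ℕ) {ε : ℝ} (hε : 0 < ε) :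
    ∃ C, 0 ≤ C ∧ ∀ a y : EuclideanSpace ℝ (Fin d),
      heat ε (a - y) ≤ C * (1 + ‖a‖) ^ N * ((1 + ‖y‖) ^ N)⁻¹ := by
  obtain ⟨C, hC, h⟩ := exists_heat_le (d := d) N hε
  refine ⟨C, hC, fun a y => (h _).trans ?_⟩
  rw [mul_assoc]
  refine mul_le_mul_of_nonneg_left ?_ hC
  rw [← div_eq_mul_inv, le_div_iff₀ (by positivity), inv_mul_le_iff₀ (by positivity), ← mul_pow]
  refine pow_le_pow_left₀ (by positivity) ?_ N
  have : ‖y‖ ≤ ‖a - y‖ + ‖a‖ := by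
    have := norm_sub_le a (a - y); rw [sub_sub_cancel] at this; linarith
  nlinarith [norm_nonneg a, norm_nonneg (a - y), mul_nonneg (norm_nonneg a) (norm_nonneg (a - y))]

lemma integral_heat_one : ∫ u : EuclideanSpace ℝ (Fin d), heat 1 u = 1 := by
  unfold heat
  rw [integral_const_mul]
  have := GaussianFourier.integral_rexp_neg_mul_sq_norm (V := EuclideanSpace ℝ (Fin d))
    (b := 1 / 2) (by norm_num)
  rw [show (fun u : EuclideanSpace ℝ (Fin d) => Real.exp (-‖u‖ ^ 2 / (2 * 1)))
    = fun u => Real.exp (-(1 / 2) * ‖u‖ ^ 2) by ext; ring_nf, this, finrank_euclideanSpace_fin,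
    show Real.pi / (1 / 2) = 2 * Real.pi * 1 by ring, ← Real.rpow_add (by positivity)]
  simp [neg_div]

lemma heat_sqrt_smul {ε : ℝ} (hε : 0 < ε) (u : EuclideanSpace ℝ (Fin d)) :
    √ε ^ d * heat ε (√ε • u) = heat 1 u := by
  unfold heat
  rw [norm_smul, Real.norm_eq_abs, abs_of_nonneg (Real.sqrt_nonneg ε), mul_pow, Real.sq_sqrt hε.le,
    show -(ε * ‖u‖ ^ 2) / (2 * ε) = -‖u‖ ^ 2 / (2 * 1) by field_simp, ← mul_assoc,
    Real.mul_rpow (by positivity) hε.le]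
  have : √ε ^ d * ε ^ (-(d : ℝ) / 2) = 1 := by
    rw [Real.sqrt_eq_rpow, ← Real.rpow_natCast, ← Real.rpow_mul hε.le, ← Real.rpow_add hε]
    simp [div_eq_inv_mul]
  rw [mul_left_comm, this, mul_one, mul_one (2 * Real.pi)]

lemma integral_heat_sub_mul {ε : ℝ} (hε : 0 < ε) (a : EuclideanSpace ℝ (Fin d))
    (f : EuclideanSpace ℝ (Fin d) → ℝ) :
    ∫ y, heat ε (a - y) * f y = ∫ u, heat 1 u * f (a - √ε • u) := by
  rw [← integral_sub_left_eq_self (fun y => heat ε (a - y) * f y) volume a]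
  have h := Measure.integral_comp_smul (volume : Measure (EuclideanSpace ℝ (Fin d)))
    (fun x => heat ε (a - (a - x)) * f (a - x)) (√ε)
  have hs : 0 < √ε ^ d := pow_pos (Real.sqrt_pos.2 hε) d
  rw [finrank_euclideanSpace_fin, abs_of_pos (inv_pos.2 hs), smul_eq_mul,
    eq_inv_mul_iff_mul_eq₀ hs.ne', ← integral_const_mul] at h
  rw [← h]
  refine integral_congr_ae (Eventually.of_forall fun u => ?_)
  simp only [sub_sub_cancel]
  rw [← mul_assoc, heat_sqrt_smul hε]

lemma PowerDecay.exists_abs_le {ρ : EuclideanSpace ℝ (Fin d) → ℝ} {β : Fin d → ℝ}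
    (h : PowerDecay ρ β) (hβ : ∀ i, 0 ≤ β i) : ∃ C, 0 ≤ C ∧ ∀ x, |ρ x| ≤ C := by
  obtain ⟨C, hC⟩ := h
  have hC0 : 0 ≤ C := by
    have := (hC 0).1.trans (hC 0).2
    simpa using this
  refine ⟨C, hC0, fun x => ?_⟩
  rw [abs_of_nonneg (hC x).1]
  refine (hC x).2.trans (mul_le_of_le_one_right hC0 (Finset.prod_le_one (fun i _ => by positivity)
    fun i _ => Real.rpow_le_one_of_one_le_of_nonpos ?_ (by linarith [hβ i])))
  linarith [abs_nonneg (x i)]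

lemma abs_fracCov_le {H : ℝ} (hH0 : 0 ≤ H) (hH1 : H ≤ 1) (ξ η : ℝ) :
    |fracCov H ξ η| ≤ 2 * ((1 + |ξ|) ^ 2 * (1 + |η|) ^ 2) := by
  have key : ∀ z : ℝ, 0 ≤ |z| ^ (2 * H) ∧ |z| ^ (2 * H) ≤ (1 + |z|) ^ 2 := fun z => by
    refine ⟨by positivity, ?_⟩
    calc |z| ^ (2 * H) ≤ (1 + |z|) ^ (2 * H) :=
          Real.rpow_le_rpow (abs_nonneg z) (by linarith) (by linarith)
      _ ≤ (1 + |z|) ^ (2 : ℝ) :=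
          Real.rpow_le_rpow_of_exponent_le (by linarith [abs_nonneg z]) (by linarith)
      _ = _ := Real.rpow_two _
  have h1 := key ξ
  have h2 := key η
  have h3 := key (ξ - η)
  have hx : 1 ≤ (1 + |ξ|) ^ 2 := one_le_pow₀ (by linarith [abs_nonneg ξ])
  have hy : 1 ≤ (1 + |η|) ^ 2 := one_le_pow₀ (by linarith [abs_nonneg η])
  have h4 : (1 + |ξ - η|) ^ 2 ≤ (1 + |ξ|) ^ 2 * (1 + |η|) ^ 2 := by
    rw [← mul_pow]
    refine pow_le_pow_left₀ (by positivity) ?_ 2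
    nlinarith [abs_sub ξ η, mul_nonneg (abs_nonneg ξ) (abs_nonneg η)]
  unfold fracCov
  rw [abs_le]
  constructor <;> nlinarith

/-- The space covariance grows at most polynomially. -/
lemma exists_abs_spaceCov_le {H : Fin (d + 1) → ℝ} (hH : ∀ i, H i ∈ Ioo (1 / 2 : ℝ) 1)
    {ρ : EuclideanSpace ℝ (Fin d) → ℝ} {c : ℝ} (hc : ∀ x, |ρ x| ≤ c) :
    ∃ C, 0 ≤ C ∧ ∀ x y, |spaceCov H ρ x y|
      ≤ C * ((1 + ‖x‖) ^ (2 * d) * (1 + ‖y‖) ^ (2 * d)) := by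
  have hc0 : 0 ≤ c := (abs_nonneg _).trans (hc 0)
  refine ⟨c * c * 2 ^ d, by positivity, fun x y => ?_⟩
  unfold spaceCov
  rw [abs_mul, abs_mul, Finset.abs_prod, mul_assoc (c * c)]
  refine mul_le_mul (mul_le_mul (hc x) (hc y) (abs_nonneg _) hc0) ?_ (by positivity) (by positivity)
  calc ∏ i : Fin d, |fracCov (H i.succ) (x i) (y i)|
      ≤ ∏ _i : Fin d, (2 * ((1 + ‖x‖) ^ 2 * (1 + ‖y‖) ^ 2)) := by
        refine Finset.prod_le_prod (fun _ _ => abs_nonneg _) fun i _ => ?_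
        refine (abs_fracCov_le (by linarith [(hH i.succ).1]) (hH i.succ).2.le _ _).trans ?_
        have hx : |x i| ≤ ‖x‖ := by simpa using PiLp.norm_apply_le x i
        have hy : |y i| ≤ ‖y‖ := by simpa using PiLp.norm_apply_le y i
        gcongr
    _ = _ := by
      rw [Finset.prod_const, Finset.card_univ, Fintype.card_fin, mul_pow, mul_pow, pow_mul, pow_mul]

lemma continuous_spaceCov {H : Fin (d + 1) → ℝ} (hH : ∀ i, 0 < H i)
    {ρ : EuclideanSpace ℝ (Fin d) → ℝ} (hρ : Continuous ρ) :
    Continuous (fun z : EuclideanSpace ℝ (Fin d) × EuclideanSpace ℝ (Fin d) =>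
      spaceCov H ρ z.1 z.2) := by
  unfold spaceCov
  refine ((hρ.comp continuous_fst).mul (hρ.comp continuous_snd)).mul
    (continuous_finsetProd _ fun i _ => ?_)
  exact (continuous_fracCov (hH i.succ)).comp
    ((by fun_prop : Continuous fun z : EuclideanSpace ℝ (Fin d) × EuclideanSpace ℝ (Fin d) =>
      (z.1 i, z.2 i)))

lemma integrable_inv_one_add_norm_pow :
    Integrable (fun y : EuclideanSpace ℝ (Fin d) => ((1 + ‖y‖) ^ (d + 1))⁻¹) := by
  have := integrable_one_add_norm (E := EuclideanSpace ℝ (Fin d)) (μ := volume) (r := (d + 1 : ℕ))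
    (by rw [finrank_euclideanSpace_fin]; exact_mod_cast Nat.lt_succ_self d)
  refine this.congr (Eventually.of_forall fun y => ?_)
  simp only
  rw [Real.rpow_neg (by positivity), Real.rpow_natCast]

/-- The integrand of the mollified space covariance has an integrable majorant which is polynomial
in the base points. -/
lemma exists_abs_heat_mul_spaceCov_le {H : Fin (d + 1) → ℝ} (hH : ∀ i, H i ∈ Ioo (1 / 2 : ℝ) 1)
    {ρ : EuclideanSpace ℝ (Fin d) → ℝ} {c : ℝ} (hc : ∀ x, |ρ x| ≤ c) {ε ε' : ℝ} (hε : 0 < ε)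
    (hε' : 0 < ε') :
    ∃ C, 0 ≤ C ∧ ∀ a b y y' : EuclideanSpace ℝ (Fin d),
      |heat ε (a - y) * heat ε' (b - y') * spaceCov H ρ y y'|
        ≤ C * ((1 + ‖a‖) ^ (3 * d + 1) * (1 + ‖b‖) ^ (3 * d + 1)) *
          (((1 + ‖y‖) ^ (d + 1))⁻¹ * ((1 + ‖y'‖) ^ (d + 1))⁻¹) := by
  obtain ⟨C₁, hC₁, h₁⟩ := exists_heat_sub_le (d := d) (3 * d + 1) hε
  obtain ⟨C₂, hC₂, h₂⟩ := exists_heat_sub_le (d := d) (3 * d + 1) hε'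
  obtain ⟨C₃, hC₃, h₃⟩ := exists_abs_spaceCov_le hH hc
  have key : ∀ y : EuclideanSpace ℝ (Fin d), ((1 + ‖y‖) ^ (3 * d + 1))⁻¹ * (1 + ‖y‖) ^ (2 * d)
      = ((1 + ‖y‖) ^ (d + 1))⁻¹ := fun y => by
    rw [show 3 * d + 1 = 2 * d + (d + 1) by ring, pow_add, mul_inv, mul_right_comm,
      inv_mul_cancel₀ (by positivity), one_mul]
  refine ⟨C₁ * C₂ * C₃, by positivity, fun a b y y' => ?_⟩
  rw [abs_mul, abs_mul, abs_of_nonneg (heat_nonneg hε _), abs_of_nonneg (heat_nonneg hε' _)]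
  calc _ ≤ (C₁ * (1 + ‖a‖) ^ (3 * d + 1) * ((1 + ‖y‖) ^ (3 * d + 1))⁻¹) *
        (C₂ * (1 + ‖b‖) ^ (3 * d + 1) * ((1 + ‖y'‖) ^ (3 * d + 1))⁻¹) *
        (C₃ * ((1 + ‖y‖) ^ (2 * d) * (1 + ‖y'‖) ^ (2 * d))) :=
        mul_le_mul (mul_le_mul (h₁ a y) (h₂ b y') (heat_nonneg hε' _) (by positivity)) (h₃ y y')
          (abs_nonneg _) (by positivity)
    _ = C₁ * C₂ * C₃ * ((1 + ‖a‖) ^ (3 * d + 1) * (1 + ‖b‖) ^ (3 * d + 1)) *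
        ((((1 + ‖y‖) ^ (3 * d + 1))⁻¹ * (1 + ‖y‖) ^ (2 * d)) *
          (((1 + ‖y'‖) ^ (3 * d + 1))⁻¹ * (1 + ‖y'‖) ^ (2 * d))) := by ring
    _ = _ := by rw [key, key]

/-- The space covariance mollified by heat kernels in both variables. -/
noncomputable def mollCov (H : Fin (d + 1) → ℝ) (ρ : EuclideanSpace ℝ (Fin d) → ℝ) (ε ε' : ℝ)
    (a b : EuclideanSpace ℝ (Fin d)) : ℝ :=
  ∫ z : EuclideanSpace ℝ (Fin d) × EuclideanSpace ℝ (Fin d),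
    heat ε (a - z.1) * heat ε' (b - z.2) * spaceCov H ρ z.1 z.2

lemma integrable_heat_mul_pow (k : ℕ) :
    Integrable (fun u : EuclideanSpace ℝ (Fin d) => heat 1 u * (1 + ‖u‖) ^ k) := by
  obtain ⟨C, hC, h⟩ := exists_heat_le (d := d) (k + (d + 1)) one_pos
  refine (integrable_inv_one_add_norm_pow.const_mul C).mono'
    ((continuous_heat 1).mul (by fun_prop)).aestronglyMeasurable (Eventually.of_forall fun u => ?_)
  rw [Real.norm_of_nonneg (mul_nonneg (heat_nonneg one_pos _) (by positivity))]
  calc _ ≤ C * ((1 + ‖u‖) ^ (k + (d + 1)))⁻¹ * (1 + ‖u‖) ^ k :=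
        mul_le_mul_of_nonneg_right (h u) (by positivity)
    _ = C * ((1 + ‖u‖) ^ (d + 1))⁻¹ := by
      rw [pow_add, mul_inv, mul_assoc, mul_right_comm, inv_mul_cancel₀ (by positivity), one_mul]

/-- After rescaling, the integrand of the mollified space covariance has an integrable majorant
which stays bounded as the mollification is removed. -/
lemma exists_abs_rescaled_le {H : Fin (d + 1) → ℝ} (hH : ∀ i, H i ∈ Ioo (1 / 2 : ℝ) 1)
    {ρ : EuclideanSpace ℝ (Fin d) → ℝ} {c : ℝ} (hc : ∀ x, |ρ x| ≤ c) :
    ∃ C, 0 ≤ C ∧ ∀ (ε ε' : ℝ) (a b u v : EuclideanSpace ℝ (Fin d)),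
      |heat 1 u * heat 1 v * spaceCov H ρ (a - √ε • u) (b - √ε' • v)|
        ≤ C * ((1 + √ε) * (1 + √ε')) ^ (2 * d) * ((1 + ‖a‖) ^ (2 * d) * (1 + ‖b‖) ^ (2 * d)) *
          ((heat 1 u * (1 + ‖u‖) ^ (2 * d)) * (heat 1 v * (1 + ‖v‖) ^ (2 * d))) := by
  obtain ⟨C, hC, h⟩ := exists_abs_spaceCov_le hH hc
  have key : ∀ (ε : ℝ) (a u : EuclideanSpace ℝ (Fin d)),
      1 + ‖a - √ε • u‖ ≤ (1 + √ε) * (1 + ‖a‖) * (1 + ‖u‖) := fun ε a u => by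
    have h1 : ‖a - √ε • u‖ ≤ ‖a‖ + √ε * ‖u‖ := by
      refine (norm_sub_le _ _).trans ?_
      rw [norm_smul, Real.norm_of_nonneg (Real.sqrt_nonneg ε)]
    have := Real.sqrt_nonneg ε
    have h2 : (1 + √ε) * (1 + ‖a‖) * (1 + ‖u‖) = 1 + ‖a‖ + √ε * ‖u‖
      + (‖u‖ + ‖a‖ * ‖u‖ + √ε + √ε * ‖a‖ + √ε * ‖a‖ * ‖u‖) := by ring
    have h3 : 0 ≤ ‖u‖ + ‖a‖ * ‖u‖ + √ε + √ε * ‖a‖ + √ε * ‖a‖ * ‖u‖ := by positivity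
    linarith
  refine ⟨C, hC, fun ε ε' a b u v => ?_⟩
  have hu := heat_nonneg one_pos u
  have hv := heat_nonneg one_pos v
  rw [abs_mul, abs_of_nonneg (mul_nonneg hu hv)]
  calc _ ≤ heat 1 u * heat 1 v * (C * (((1 + √ε) * (1 + ‖a‖) * (1 + ‖u‖)) ^ (2 * d) *
        ((1 + √ε') * (1 + ‖b‖) * (1 + ‖v‖)) ^ (2 * d))) := by
        refine mul_le_mul_of_nonneg_left ((h _ _).trans ?_) (mul_nonneg hu hv)
        have := key ε a u
        have := key ε' b v
        gcongr
    _ = _ := by simp only [mul_pow]; ring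

/-- Brownian scaling moves the mollification parameters into the arguments of the covariance. -/
lemma mollCov_eq {H : Fin (d + 1) → ℝ} (hH : ∀ i, H i ∈ Ioo (1 / 2 : ℝ) 1)
    {ρ : EuclideanSpace ℝ (Fin d) → ℝ} (hρ : Continuous ρ) {c : ℝ} (hc : ∀ x, |ρ x| ≤ c)
    {ε ε' : ℝ} (hε : 0 < ε) (hε' : 0 < ε') (a b : EuclideanSpace ℝ (Fin d)) :
    mollCov H ρ ε ε' a b = ∫ z : EuclideanSpace ℝ (Fin d) × EuclideanSpace ℝ (Fin d),
      heat 1 z.1 * heat 1 z.2 * spaceCov H ρ (a - √ε • z.1) (b - √ε' • z.2) := by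
  have hq := continuous_spaceCov (fun i => by linarith [(hH i).1]) (H := H) hρ
  have hh := fun ε => continuous_heat (d := d) ε
  have hI : Integrable (fun z : EuclideanSpace ℝ (Fin d) × EuclideanSpace ℝ (Fin d) =>
      heat ε (a - z.1) * heat ε' (b - z.2) * spaceCov H ρ z.1 z.2) := by
    obtain ⟨C, hC, h⟩ := exists_abs_heat_mul_spaceCov_le hH hc hε hε'
    refine Integrable.mono' ((integrable_inv_one_add_norm_pow.mul_prod
      integrable_inv_one_add_norm_pow).const_mul
        (C * ((1 + ‖a‖) ^ (3 * d + 1) * (1 + ‖b‖) ^ (3 * d + 1)))) ?_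
      (Eventually.of_forall fun z => h a b z.1 z.2)
    exact ((((hh ε).comp (by fun_prop)).mul ((hh ε').comp (by fun_prop))).mul
      hq).aestronglyMeasurable
  have hI' : Integrable (fun z : EuclideanSpace ℝ (Fin d) × EuclideanSpace ℝ (Fin d) =>
      heat 1 z.1 * heat 1 z.2 * spaceCov H ρ (a - √ε • z.1) (b - √ε' • z.2)) := by
    obtain ⟨C, hC, h⟩ := exists_abs_rescaled_le hH hc
    refine Integrable.mono' (((integrable_heat_mul_pow (2 * d)).mul_prod
      (integrable_heat_mul_pow (2 * d))).const_mul (C * ((1 + √ε) * (1 + √ε')) ^ (2 * d) *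
        ((1 + ‖a‖) ^ (2 * d) * (1 + ‖b‖) ^ (2 * d)))) ?_
      (Eventually.of_forall fun z => h ε ε' a b z.1 z.2)
    exact ((((hh 1).comp continuous_fst).mul ((hh 1).comp continuous_snd)).mul
      (hq.comp (by fun_prop : Continuous fun z : EuclideanSpace ℝ (Fin d) ×
        EuclideanSpace ℝ (Fin d) => (a - √ε • z.1, b - √ε' • z.2)))).aestronglyMeasurable
  rw [mollCov, Measure.volume_eq_prod, integral_prod _ hI, integral_prod _ hI']
  simp only [mul_assoc, integral_const_mul]
  simp_rw [integral_heat_sub_mul hε' b]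
  exact integral_heat_sub_mul hε a (fun y => ∫ v, heat 1 v * spaceCov H ρ y (b - √ε' • v))

lemma exists_abs_mollCov_le {H : Fin (d + 1) → ℝ} (hH : ∀ i, H i ∈ Ioo (1 / 2 : ℝ) 1)
    {ρ : EuclideanSpace ℝ (Fin d) → ℝ} (hρ : Continuous ρ) {c : ℝ} (hc : ∀ x, |ρ x| ≤ c) :
    ∃ C, 0 ≤ C ∧ ∀ ε ε' : ℝ, 0 < ε → ε ≤ 1 → 0 < ε' → ε' ≤ 1 →
      ∀ a b : EuclideanSpace ℝ (Fin d),
        |mollCov H ρ ε ε' a b| ≤ C * ((1 + ‖a‖) ^ (2 * d) * (1 + ‖b‖) ^ (2 * d)) := by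
  obtain ⟨C, hC, h⟩ := exists_abs_rescaled_le hH hc
  set I := ∫ z : EuclideanSpace ℝ (Fin d) × EuclideanSpace ℝ (Fin d),
    (heat 1 z.1 * (1 + ‖z.1‖) ^ (2 * d)) * (heat 1 z.2 * (1 + ‖z.2‖) ^ (2 * d)) with hI
  have hI0 : 0 ≤ I := integral_nonneg fun z =>
    mul_nonneg (mul_nonneg (heat_nonneg one_pos _) (by positivity))
      (mul_nonneg (heat_nonneg one_pos _) (by positivity))
  refine ⟨C * 4 ^ (2 * d) * I, by positivity, fun ε ε' hε hε1 hε' hε1' a b => ?_⟩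
  rw [mollCov_eq hH hρ hc hε hε']
  have hle := norm_integral_le_of_norm_le (f := fun z : EuclideanSpace ℝ (Fin d) ×
      EuclideanSpace ℝ (Fin d) => heat 1 z.1 * heat 1 z.2 *
        spaceCov H ρ (a - √ε • z.1) (b - √ε' • z.2)) (((integrable_heat_mul_pow (2 * d)).mul_prod
      (integrable_heat_mul_pow (2 * d))).const_mul (C * ((1 + √ε) * (1 + √ε')) ^ (2 * d) *
        ((1 + ‖a‖) ^ (2 * d) * (1 + ‖b‖) ^ (2 * d))))
      (Eventually.of_forall fun z => h ε ε' a b z.1 z.2)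
  rw [integral_const_mul] at hle
  refine hle.trans ?_
  have h1 : √ε ≤ 1 := Real.sqrt_le_one.2 hε1
  have h2 : √ε' ≤ 1 := Real.sqrt_le_one.2 hε1'
  have h3 : ((1 + √ε) * (1 + √ε')) ≤ 4 := by
    nlinarith [Real.sqrt_nonneg ε, Real.sqrt_nonneg ε']
  calc _ ≤ C * 4 ^ (2 * d) * ((1 + ‖a‖) ^ (2 * d) * (1 + ‖b‖) ^ (2 * d)) * I := by
        rw [hI, Measure.volume_eq_prod] at *
        gcongr
    _ = _ := by ring

lemma tendsto_mollCov {H : Fin (d + 1) → ℝ} (hH : ∀ i, H i ∈ Ioo (1 / 2 : ℝ) 1)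
    {ρ : EuclideanSpace ℝ (Fin d) → ℝ} (hρ : Continuous ρ) {c : ℝ} (hc : ∀ x, |ρ x| ≤ c)
    (a b : EuclideanSpace ℝ (Fin d)) :
    Tendsto (fun q : ℝ × ℝ => mollCov H ρ q.1 q.2 a b) (𝓝[>] (0 : ℝ) ×ˢ 𝓝[>] (0 : ℝ))
      (𝓝 (spaceCov H ρ a b)) := by
  obtain ⟨C, hC, h⟩ := exists_abs_rescaled_le hH hc
  have hq := continuous_spaceCov (fun i => by linarith [(hH i).1]) (H := H) hρ
  have hh := continuous_heat (d := d) 1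
  have hsmall : ∀ᶠ ε : ℝ in 𝓝[>] (0 : ℝ), 0 < ε ∧ ε ≤ 1 :=
    Filter.Eventually.and self_mem_nhdsWithin (nhdsWithin_le_nhds (Iic_mem_nhds one_pos))
  have hlim : Tendsto (fun q : ℝ × ℝ => ∫ z : EuclideanSpace ℝ (Fin d) × EuclideanSpace ℝ (Fin d),
      heat 1 z.1 * heat 1 z.2 * spaceCov H ρ (a - √q.1 • z.1) (b - √q.2 • z.2))
      (𝓝[>] (0 : ℝ) ×ˢ 𝓝[>] (0 : ℝ))
      (𝓝 (∫ z : EuclideanSpace ℝ (Fin d) × EuclideanSpace ℝ (Fin d),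
        heat 1 z.1 * heat 1 z.2 * spaceCov H ρ a b)) := by
    refine tendsto_integral_filter_of_dominated_convergence _
      (Eventually.of_forall fun q => ?_) ?_ (((integrable_heat_mul_pow (2 * d)).mul_prod
        (integrable_heat_mul_pow (2 * d))).const_mul (C * 4 ^ (2 * d) *
          ((1 + ‖a‖) ^ (2 * d) * (1 + ‖b‖) ^ (2 * d)))) (Eventually.of_forall fun z => ?_)
    · exact (((hh.comp continuous_fst).mul (hh.comp continuous_snd)).mul
        (hq.comp (by fun_prop : Continuous fun z : EuclideanSpace ℝ (Fin d) ×
          EuclideanSpace ℝ (Fin d) => (a - √q.1 • z.1, b - √q.2 • z.2)))).aestronglyMeasurable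
    · filter_upwards [hsmall.prod_mk hsmall] with q ⟨⟨_, h1⟩, _, h2⟩
      refine Eventually.of_forall fun z => (h q.1 q.2 a b z.1 z.2).trans ?_
      have h1 : √q.1 ≤ 1 := Real.sqrt_le_one.2 h1
      have h2 : √q.2 ≤ 1 := Real.sqrt_le_one.2 h2
      have h3 : ((1 + √q.1) * (1 + √q.2)) ≤ 4 := by
        nlinarith [Real.sqrt_nonneg q.1, Real.sqrt_nonneg q.2]
      have hu := heat_nonneg one_pos z.1
      have hv := heat_nonneg one_pos z.2
      gcongr
    · have hs : ContinuousAt (fun q : ℝ × ℝ => heat 1 z.1 * heat 1 z.2 *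
          spaceCov H ρ (a - √q.1 • z.1) (b - √q.2 • z.2)) (0, 0) :=
        (continuous_const.mul (hq.comp (by fun_prop : Continuous fun q : ℝ × ℝ =>
          (a - √q.1 • z.1, b - √q.2 • z.2)))).continuousAt
      have := hs.tendsto
      simp only [Real.sqrt_zero, zero_smul, sub_zero] at this
      refine this.mono_left ?_
      rw [nhds_prod_eq]
      exact Filter.prod_mono nhdsWithin_le_nhds nhdsWithin_le_nhds
  rw [integral_mul_const, Measure.volume_eq_prod, integral_prod_mul (heat 1) (heat 1),
    integral_heat_one, one_mul, one_mul] at hlim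
  refine hlim.congr' ?_
  filter_upwards [hsmall.prod_mk hsmall] with q ⟨⟨h1, _⟩, h2, _⟩
  rw [mollCov_eq hH hρ hc h1 h2, Measure.volume_eq_prod]

end

/-! ### Moments and joint measurability of Brownian motion -/

section

lemma multivariateGaussian_smul_one {d : ℕ} {s : ℝ} (hs : 0 ≤ s) :
    multivariateGaussian 0 (s • (1 : Matrix (Fin d) (Fin d) ℝ))
      = (stdGaussian (EuclideanSpace ℝ (Fin d))).map (fun x => √s • x) := by
  have : IsProbabilityMeasure ((stdGaussian (EuclideanSpace ℝ (Fin d))).map (fun x => √s • x)) :=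
    Measure.isProbabilityMeasure_map (by fun_prop)
  refine Measure.ext_of_charFun (funext fun x => ?_)
  rw [charFun_multivariateGaussian (Matrix.PosSemidef.one.smul hs), charFun_map_smul,
    charFun_stdGaussian, norm_smul, Real.norm_of_nonneg (Real.sqrt_nonneg s)]
  congr 1
  have h1 : x.ofLp ⬝ᵥ (s • (1 : Matrix (Fin d) (Fin d) ℝ)).mulVec x.ofLp = s * ‖x‖ ^ 2 := by
    rw [Matrix.smul_mulVec, Matrix.one_mulVec, dotProduct_smul, smul_eq_mul,
      EuclideanSpace.real_norm_sq_eq]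
    simp [dotProduct, sq]
  rw [h1]
  have h2 : ((√s : ℝ) : ℂ) ^ 2 = (s : ℂ) := by
    rw [← Complex.ofReal_pow, Real.sq_sqrt hs]
  push_cast
  rw [mul_pow, h2]
  simp
  ring

variable {Ω : Type*} [mΩ : MeasurableSpace Ω] {P : Measure Ω} {d : ℕ} {T : ℝ}
  {B : ℝ → Ω → EuclideanSpace ℝ (Fin d)}

lemma IsStdBrownianMotion.hasLaw (hB : IsStdBrownianMotion T B P) {s : ℝ} (hs : s ∈ Icc 0 T) :
    HasLaw (B s) (multivariateGaussian 0 (s • (1 : Matrix (Fin d) (Fin d) ℝ))) P := by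
  have := hB.law_increments 0 s le_rfl hs.1 hs.2
  rw [sub_zero] at this
  refine this.congr ?_
  filter_upwards [hB.zero] with ω hω
  rw [hω, sub_zero]

/-- Moments of Brownian motion are bounded on `[0, T]`. -/
lemma IsStdBrownianMotion.exists_moment_le (hB : IsStdBrownianMotion T B P) (k : ℕ) :
    ∃ M, ∀ s ∈ Icc 0 T, Integrable (fun ω => (1 + ‖B s ω‖) ^ k) P ∧
      ∫ ω, (1 + ‖B s ω‖) ^ k ∂P ≤ M := by
  set γ := stdGaussian (EuclideanSpace ℝ (Fin d)) with hγ
  have hint : ∀ r : ℝ, Integrable (fun x : EuclideanSpace ℝ (Fin d) => (1 + r * ‖x‖) ^ k) γ := by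
    intro r
    rcases eq_or_ne k 0 with rfl | hk
    · simp
    have h1 : MemLp (fun x : EuclideanSpace ℝ (Fin d) => 1 + r * ‖x‖) k γ :=
      (memLp_const (1 : ℝ)).add
        (((IsGaussian.memLp_id γ k (ENNReal.natCast_ne_top k)).norm).const_mul r)
    have h2 := h1.integrable_norm_pow hk
    refine h2.mono' (by fun_prop) (Eventually.of_forall fun x => ?_)
    rw [norm_pow]
  refine ⟨∫ x, (1 + √T * ‖x‖) ^ k ∂γ, fun s hs => ?_⟩
  have hlaw := hB.hasLaw hs
  rw [multivariateGaussian_smul_one hs.1] at hlaw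
  have hsm : Measurable fun x : EuclideanSpace ℝ (Fin d) => √s • x := by fun_prop
  have hf : Measurable fun x : EuclideanSpace ℝ (Fin d) => (1 + ‖x‖) ^ k := by fun_prop
  have heq : (fun x : EuclideanSpace ℝ (Fin d) => (1 + ‖√s • x‖) ^ k)
      = fun x => (1 + √s * ‖x‖) ^ k := by
    ext x; rw [norm_smul, Real.norm_of_nonneg (Real.sqrt_nonneg s)]
  constructor
  · have h1 : Integrable (fun x : EuclideanSpace ℝ (Fin d) => (1 + ‖x‖) ^ k) (P.map (B s)) := by
      rw [hlaw.map_eq, integrable_map_measure hf.aestronglyMeasurable hsm.aemeasurable]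
      change Integrable (fun x : EuclideanSpace ℝ (Fin d) => (1 + ‖√s • x‖) ^ k) γ
      rw [heq]
      exact hint _
    exact (integrable_map_measure hf.aestronglyMeasurable hlaw.aemeasurable).1 h1
  · have h1 := hlaw.integral_comp (f := fun x => (1 + ‖x‖) ^ k) hf.aestronglyMeasurable
    simp only [Function.comp] at h1
    rw [h1, integral_map hsm.aemeasurable hf.aestronglyMeasurable, heq]
    refine integral_mono (hint _) (hint _) fun x => ?_
    have := Real.sqrt_le_sqrt hs.2
    simp only
    gcongr

lemma IsStdBrownianMotion.exists_moment_mul_le (hB : IsStdBrownianMotion T B P) (k : ℕ) :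
    ∃ M, 0 ≤ M ∧ ∀ s ∈ Icc 0 T, ∀ s' ∈ Icc 0 T,
      Integrable (fun ω => (1 + ‖B s ω‖) ^ k * (1 + ‖B s' ω‖) ^ k) P ∧
      ∫ ω, (1 + ‖B s ω‖) ^ k * (1 + ‖B s' ω‖) ^ k ∂P ≤ M := by
  obtain ⟨M, hM⟩ := hB.exists_moment_le (2 * k)
  refine ⟨max M 0, le_max_right _ _, fun s hs s' hs' => ?_⟩
  obtain ⟨h1, h1'⟩ := hM s hs
  obtain ⟨h2, h2'⟩ := hM s' hs'
  have hle : ∀ ω, (1 + ‖B s ω‖) ^ k * (1 + ‖B s' ω‖) ^ k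
      ≤ ((1 + ‖B s ω‖) ^ (2 * k) + (1 + ‖B s' ω‖) ^ (2 * k)) / 2 := fun ω => by
    rw [mul_comm 2 k, pow_mul, pow_mul]
    linarith [two_mul_le_add_sq ((1 + ‖B s ω‖) ^ k) ((1 + ‖B s' ω‖) ^ k)]
  have hi : Integrable (fun ω => (1 + ‖B s ω‖) ^ k * (1 + ‖B s' ω‖) ^ k) P := by
    have := hB.measurable s hs
    have := hB.measurable s' hs'
    refine ((h1.add h2).div_const 2).mono' (by fun_prop) (Eventually.of_forall fun ω => ?_)
    rw [Real.norm_of_nonneg (by positivity)]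
    exact hle ω
  refine ⟨hi, (integral_mono hi ((h1.add h2).div_const 2) hle).trans ?_⟩
  simp only [Pi.add_apply]
  rw [integral_div, integral_add h1 h2]
  linarith [le_max_left M 0]

/-- A process with continuous paths on `[0, T]` has a jointly measurable version, for whatever
σ-algebra makes each of its values on `[0, T]` measurable. -/
lemma exists_measurable_version {Ω E : Type*} {m : MeasurableSpace Ω} [TopologicalSpace E]
    [TopologicalSpace.IsCompletelyMetrizableSpace E] [SecondCountableTopology E]
    [MeasurableSpace E] [BorelSpace E] [Nonempty E] (B : ℝ → Ω → E) (hT : 0 ≤ T)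
    (hB : ∀ s ∈ Icc 0 T, Measurable (B s)) :
    ∃ B' : ℝ → Ω → E, Measurable (Function.uncurry B') ∧
      ∀ ω, ContinuousOn (fun s => B s ω) (Icc 0 T) → ∀ s ∈ Icc 0 T, B' s ω = B s ω := by
  -- piecewise constant interpolation on a grid of mesh `1 / (n + 1)`
  set π : ℕ → ℝ → ℝ := fun n s => max 0 (min T (⌊s * (n + 1)⌋ / (n + 1))) with hπ
  have hmem : ∀ n s, π n s ∈ Icc 0 T := fun n s =>
    ⟨le_max_left _ _, max_le hT (min_le_left _ _)⟩
  let _ := TopologicalSpace.upgradeIsCompletelyMetrizable E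
  have hmeas : ∀ n, StronglyMeasurable (fun z : ℝ × Ω => B (π n z.1) z.2) := fun n => by
    have h1 : Measurable (fun z : ℤ × Ω => B (max 0 (min T (z.1 / (n + 1)))) z.2) :=
      measurable_from_prod_countable_right fun k =>
        hB (max 0 (min T ((k : ℝ) / (n + 1)))) ⟨le_max_left _ _, max_le hT (min_le_left _ _)⟩
    have h2 : Measurable (fun z : ℝ × Ω => (⌊z.1 * (n + 1)⌋, z.2)) :=
      (Int.measurable_floor.comp (by fun_prop)).prodMk measurable_snd
    exact (h1.comp h2).stronglyMeasurable
  refine ⟨fun s ω => limUnder atTop fun n => B (π n s) ω,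
    (StronglyMeasurable.limUnder (l := atTop) hmeas).measurable, fun ω hω s hs => ?_⟩
  have hlim : Tendsto (fun n => π n s) atTop (𝓝 s) := by
    have h1 : Tendsto (fun n : ℕ => (⌊s * (n + 1)⌋ : ℝ) / (n + 1)) atTop (𝓝 s) := by
      have h2 : Tendsto (fun n : ℕ => s - 1 / ((n : ℝ) + 1)) atTop (𝓝 s) := by
        simpa using (tendsto_one_div_add_atTop_nhds_zero_nat (𝕜 := ℝ)).const_sub s
      refine tendsto_of_tendsto_of_tendsto_of_le_of_le h2 tendsto_const_nhds (fun n => ?_)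
        (fun n => ?_)
      · have hn : (0 : ℝ) < n + 1 := by positivity
        simp only
        rw [le_div_iff₀ hn, sub_mul, one_div, inv_mul_cancel₀ hn.ne']
        linarith [Int.lt_floor_add_one (s * ((n : ℝ) + 1))]
      · have hn : (0 : ℝ) < n + 1 := by positivity
        simp only
        rw [div_le_iff₀ hn]
        exact Int.floor_le _
    have h3 := (tendsto_const_nhds (x := (0 : ℝ))).max ((tendsto_const_nhds (x := T)).min h1)
    rwa [min_eq_right hs.2, max_eq_right hs.1] at h3
  refine Tendsto.limUnder_eq ?_
  exact ((hω s hs).tendsto.comp (tendsto_nhdsWithin_iff.2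
    ⟨hlim, Eventually.of_forall fun n => hmem n s⟩))

lemma measurable_varDensity {Ω : Type*} {m : MeasurableSpace Ω} {H : Fin (d + 1) → ℝ}
    (hH : ∀ i, 0 < H i) {ρ : EuclideanSpace ℝ (Fin d) → ℝ} (hρ : Continuous ρ)
    {B' : ℝ → Ω → EuclideanSpace ℝ (Fin d)} (hB' : Measurable (Function.uncurry B')) :
    Measurable (fun z : (ℝ × ℝ) × Ω => varDensity H ρ (fun r => B' r z.2) z.1.1 z.1.2) := by
  unfold varDensity
  have h1 : Measurable fun z : (ℝ × ℝ) × Ω => (B' z.1.1 z.2, B' z.1.2 z.2) :=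
    (hB'.comp (by fun_prop : Measurable fun z : (ℝ × ℝ) × Ω => (z.1.1, z.2))).prodMk
      (hB'.comp (by fun_prop : Measurable fun z : (ℝ × ℝ) × Ω => (z.1.2, z.2)))
  refine Measurable.mul ?_ ((continuous_spaceCov hH hρ).measurable.comp h1)
  exact Measurable.pow_const (by fun_prop) _

lemma stronglyMeasurable_integral_varDensity {Ω : Type*} {m : MeasurableSpace Ω}
    {H : Fin (d + 1) → ℝ} (hH : ∀ i, 0 < H i) {ρ : EuclideanSpace ℝ (Fin d) → ℝ}
    (hρ : Continuous ρ) {B' : ℝ → Ω → EuclideanSpace ℝ (Fin d)}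
    (hB' : Measurable (Function.uncurry B')) (a : ℝ) (S : Set (ℝ × ℝ)) :
    StronglyMeasurable fun ω => a * ∫ p in S, varDensity H ρ (fun r => B' r ω) p.1 p.2 :=
  ((measurable_varDensity hH hρ hB').stronglyMeasurable.integral_prod_left').const_mul a

/-- The variance density is integrable in time and probability together. -/
lemma IsStdBrownianMotion.integrable_varDensity [IsProbabilityMeasure P]
    (hB : IsStdBrownianMotion T B P) {H : Fin (d + 1) → ℝ}
    (hH : ∀ i, H i ∈ Ioo (1 / 2 : ℝ) 1) {ρ : EuclideanSpace ℝ (Fin d) → ℝ} (hρ : Continuous ρ)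
    {c : ℝ} (hc : ∀ x, |ρ x| ≤ c) {B' : ℝ → Ω → EuclideanSpace ℝ (Fin d)}
    (hB' : Measurable (Function.uncurry B')) (hBB' : ∀ s ∈ Icc 0 T, B' s =ᵐ[P] B s) {t : ℝ}
    (ht : 0 ≤ t) :
    Integrable (fun z : (ℝ × ℝ) × Ω => varDensity H ρ (fun r => B' r z.2) z.1.1 z.1.2)
      ((volume.restrict (Icc t T ×ˢ Icc t T)).prod P) := by
  obtain ⟨C, hC, hq⟩ := exists_abs_spaceCov_le hH hc
  obtain ⟨M, hM, hmom⟩ := hB.exists_moment_mul_le (2 * d)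
  have hm := measurable_varDensity (fun i => by linarith [(hH i).1]) hρ hB' (H := H)
  have hkey : ∀ p ∈ Icc t T ×ˢ Icc t T,
      Integrable (fun ω => varDensity H ρ (fun r => B' r ω) p.1 p.2) P ∧
      ∫ ω, ‖varDensity H ρ (fun r => B' r ω) p.1 p.2‖ ∂P
        ≤ C * M * |p.1 - p.2| ^ (2 * H 0 - 2) := by
    rintro p ⟨h1, h2⟩
    have hp1 : p.1 ∈ Icc 0 T := ⟨ht.trans h1.1, h1.2⟩
    have hp2 : p.2 ∈ Icc 0 T := ⟨ht.trans h2.1, h2.2⟩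
    obtain ⟨hi, hi'⟩ := hmom _ hp1 _ hp2
    have hle : ∀ᵐ ω ∂P, ‖varDensity H ρ (fun r => B' r ω) p.1 p.2‖
        ≤ |p.1 - p.2| ^ (2 * H 0 - 2) *
          (C * ((1 + ‖B p.1 ω‖) ^ (2 * d) * (1 + ‖B p.2 ω‖) ^ (2 * d))) := by
      filter_upwards [hBB' _ hp1, hBB' _ hp2] with ω hω1 hω2
      rw [varDensity, norm_mul, Real.norm_of_nonneg (by positivity), hω1, hω2]
      exact mul_le_mul_of_nonneg_left (hq _ _) (by positivity)
    have hint := ((hi.const_mul C).const_mul (|p.1 - p.2| ^ (2 * H 0 - 2)))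
    have hI : Integrable (fun ω => varDensity H ρ (fun r => B' r ω) p.1 p.2) P :=
      hint.mono' (hm.comp measurable_prodMk_left).aestronglyMeasurable hle
    refine ⟨hI, (integral_mono_ae hI.norm hint hle).trans ?_⟩
    rw [integral_const_mul, integral_const_mul, mul_comm]
    gcongr
  rw [integrable_prod_iff hm.aestronglyMeasurable]
  have hS : MeasurableSet (Icc t T ×ˢ Icc t T) := measurableSet_Icc.prod measurableSet_Icc
  constructor
  · filter_upwards [ae_restrict_mem hS] with p hp using (hkey p hp).1
  · refine ((integrableOn_abs_sub_rpow (b := 2 * H 0 - 2) (by linarith [(hH 0).1]) t T).const_mul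
      (C * M)).mono' ?_ ?_
    · exact (hm.norm.stronglyMeasurable.integral_prod_right').aestronglyMeasurable
    · filter_upwards [ae_restrict_mem hS] with p hp
      rw [Real.norm_of_nonneg (integral_nonneg fun _ => norm_nonneg _)]
      exact (hkey p hp).2

lemma IsStdBrownianMotion.sigmaB_le (hB : IsStdBrownianMotion T B P) : sigmaB T B ≤ mΩ :=
  iSup_le fun s => (hB.measurable s s.2).comap_le

lemma measurable_sigmaB {Ω : Type*} {B : ℝ → Ω → EuclideanSpace ℝ (Fin d)} {s : ℝ}
    (hs : s ∈ Icc 0 T) : Measurable[sigmaB T B] (B s) :=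
  Measurable.mono (comap_measurable (B s))
    (le_iSup (fun s : Icc (0 : ℝ) T => MeasurableSpace.comap (B s) inferInstance) ⟨s, hs⟩) le_rfl

lemma IsStdBrownianMotion.exists_measurable_version (hB : IsStdBrownianMotion T B P)
    (hT : 0 ≤ T) :
    ∃ B' : ℝ → Ω → EuclideanSpace ℝ (Fin d),
      Measurable[(inferInstance : MeasurableSpace ℝ).prod (sigmaB T B)] (Function.uncurry B') ∧
      Measurable (Function.uncurry B') ∧ ∀ᵐ ω ∂P, ∀ s ∈ Icc 0 T, B' s ω = B s ω := by
  obtain ⟨B', h1, h2⟩ := FracNoise.exists_measurable_version (m := sigmaB T B) B hT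
    (fun s hs => measurable_sigmaB hs)
  refine ⟨B', h1, h1.mono (sup_le_sup le_rfl (MeasurableSpace.comap_mono hB.sigmaB_le)) le_rfl, ?_⟩
  filter_upwards [hB.continuous_paths] with ω hω using h2 ω hω

lemma variance_congr {Ω : Type*} {B : ℝ → Ω → EuclideanSpace ℝ (Fin d)}
    {H : Fin (d + 1) → ℝ} {ρ : EuclideanSpace ℝ (Fin d) → ℝ}
    {B' : ℝ → Ω → EuclideanSpace ℝ (Fin d)} {t : ℝ} (ht : t ∈ Icc 0 T) {ω : Ω}
    (h : ∀ s ∈ Icc 0 T, B' s ω = B s ω)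
    (hi : IntegrableOn (fun p : ℝ × ℝ => varDensity H ρ (fun r => B' r ω) p.1 p.2)
      (Icc t T ×ˢ Icc t T)) :
    variance H ρ B T t ω = alphaH (H 0) *
      ∫ p in Icc t T ×ˢ Icc t T, varDensity H ρ (fun r => B' r ω) p.1 p.2 := by
  unfold variance
  congr 1
  rw [Measure.volume_eq_prod, ← Measure.prod_restrict, integral_prod,
    intervalIntegral.integral_of_le ht.2, ← integral_Icc_eq_integral_Ioc]
  · refine setIntegral_congr_fun measurableSet_Icc fun s hs => ?_
    simp only
    rw [intervalIntegral.integral_of_le ht.2, ← integral_Icc_eq_integral_Ioc]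
    refine setIntegral_congr_fun measurableSet_Icc fun s' hs' => ?_
    simp only [varDensity]
    rw [h s ⟨ht.1.trans hs.1, hs.2⟩, h s' ⟨ht.1.trans hs'.1, hs'.2⟩]
  · rwa [Measure.prod_restrict]

/-- The conditional variance is an integrable random variable, measurable with respect to the
Brownian motion up to null sets, and its integrals over events are obtained by Fubini. -/
lemma IsStdBrownianMotion.variance_properties [IsProbabilityMeasure P]
    (hB : IsStdBrownianMotion T B P) {H : Fin (d + 1) → ℝ}
    (hH : ∀ i, H i ∈ Ioo (1 / 2 : ℝ) 1) {ρ : EuclideanSpace ℝ (Fin d) → ℝ} (hρ : Continuous ρ)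
    {c : ℝ} (hc : ∀ x, |ρ x| ≤ c) {t : ℝ} (ht : t ∈ Icc 0 T) :
    (∀ᵐ ω ∂P, IntegrableOn (fun p : ℝ × ℝ => varDensity H ρ (fun r => B r ω) p.1 p.2)
      (Icc t T ×ˢ Icc t T)) ∧
    Integrable (variance H ρ B T t) P ∧
    AEStronglyMeasurable[sigmaB T B] (variance H ρ B T t) P ∧
    ∀ A, MeasurableSet A → ∫ ω in A, variance H ρ B T t ω ∂P =
      ∫ p in Icc t T ×ˢ Icc t T, alphaH (H 0) * |p.1 - p.2| ^ (2 * H 0 - 2) *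
        ∫ ω in A, spaceCov H ρ (B p.1 ω) (B p.2 ω) ∂P := by
  obtain ⟨B', hBm, hB', hBB'⟩ := hB.exists_measurable_version (ht.1.trans ht.2)
  have hBs : ∀ s ∈ Icc 0 T, B' s =ᵐ[P] B s := fun s hs => by
    filter_upwards [hBB'] with ω hω using hω s hs
  have hint := hB.integrable_varDensity hH hρ hc hB' hBs ht.1
  have hS : MeasurableSet (Icc t T ×ˢ Icc t T) := measurableSet_Icc.prod measurableSet_Icc
  have hae : ∀ᵐ ω ∂P, IntegrableOn (fun p : ℝ × ℝ => varDensity H ρ (fun r => B' r ω) p.1 p.2)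
      (Icc t T ×ˢ Icc t T) := hint.prod_left_ae
  have hvar : variance H ρ B T t =ᵐ[P] fun ω => alphaH (H 0) *
      ∫ p in Icc t T ×ˢ Icc t T, varDensity H ρ (fun r => B' r ω) p.1 p.2 := by
    filter_upwards [hae, hBB'] with ω h1 h2 using variance_congr ht h2 h1
  refine ⟨?_, ?_, ?_, fun A hA => ?_⟩
  · filter_upwards [hae, hBB'] with ω h1 h2
    refine h1.congr_fun (fun p hp => ?_) hS
    simp only [varDensity]
    rw [h2 p.1 ⟨ht.1.trans hp.1.1, hp.1.2⟩, h2 p.2 ⟨ht.1.trans hp.2.1, hp.2.2⟩]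
  · exact (hint.integral_prod_right.const_mul _).congr hvar.symm
  · refine ⟨_, ?_, hvar⟩
    exact stronglyMeasurable_integral_varDensity (m := sigmaB T B)
      (fun i => by linarith [(hH i).1]) hρ hBm _ _
  · rw [integral_congr_ae (ae_restrict_of_ae hvar), integral_const_mul]
    have hA' : Integrable (fun z : (ℝ × ℝ) × Ω =>
        varDensity H ρ (fun r => B' r z.2) z.1.1 z.1.2)
        ((volume.restrict (Icc t T ×ˢ Icc t T)).prod (P.restrict A)) := by
      have := hint.restrict (s := univ ×ˢ A)
      rwa [← Measure.prod_restrict, Measure.restrict_univ] at this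
    have hswap : ∫ ω in A, (∫ p in Icc t T ×ˢ Icc t T, varDensity H ρ (fun r => B' r ω) p.1 p.2) ∂P
        = ∫ p in Icc t T ×ˢ Icc t T, ∫ ω in A, varDensity H ρ (fun r => B' r ω) p.1 p.2 ∂P :=
      integral_integral_swap hA'.swap
    rw [hswap, ← integral_const_mul]
    refine setIntegral_congr_fun hS fun p hp => ?_
    simp only [varDensity]
    rw [integral_const_mul, mul_assoc]
    congr 2
    refine integral_congr_ae (ae_restrict_of_ae ?_)
    filter_upwards [hBs p.1 ⟨ht.1.trans hp.1.1, hp.1.2⟩, hBs p.2 ⟨ht.1.trans hp.2.1, hp.2.2⟩]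
      with ω h1 h2
    rw [h1, h2]

end

/-! ### Conditionally Gaussian elements of `L²` -/

section

lemma toL2_eq {Ω : Type*} [MeasurableSpace Ω] {P : Measure Ω} {X : Ω → ℝ} (h : MemLp X 2 P) :
    toL2 P X = h.toLp X := dif_pos h

lemma coeFn_toL2 {Ω : Type*} [MeasurableSpace Ω] {P : Measure Ω} {X : Ω → ℝ} (h : MemLp X 2 P) :
    toL2 P X =ᵐ[P] X := by rw [toL2_eq h]; exact h.coeFn_toLp

lemma memLp_bounded_mul {Ω : Type*} [MeasurableSpace Ω] {P : Measure Ω} {Z X : Ω → ℝ} {C : ℝ}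
    (hZ : Measurable Z) (hC : ∀ ω, |Z ω| ≤ C) (hX : MemLp X 2 P) :
    MemLp (fun ω => Z ω * X ω) 2 P :=
  hX.of_le_mul (hZ.aestronglyMeasurable.mul hX.aestronglyMeasurable) (c := C)
    (Eventually.of_forall fun ω => by
      rw [norm_mul]; exact mul_le_mul_of_nonneg_right (hC ω) (norm_nonneg _))

/-- The characteristic function of a linear combination of a centered Gaussian process. -/
lemma integral_cexp_sum_of_isGaussianProcess {Ω κ : Type*} [Fintype κ] [MeasurableSpace Ω]
    {P : Measure Ω} {X : κ → Ω → ℝ} (hX : IsGaussianProcess X P)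
    (hmean : ∀ k, ∫ ω, X k ω ∂P = 0) (z : κ → ℝ) :
    ∫ ω, Complex.exp ((∑ k, z k * X k ω : ℝ) * Complex.I) ∂P
      = Complex.exp (-(∑ j, ∑ k, z j * z k * ∫ ω, X j ω * X k ω ∂P : ℝ) / 2) := by
  have := hX.isProbabilityMeasure
  have hL2 : ∀ k, MemLp (X k) 2 P := fun k => (hX.hasGaussianLaw_eval k).memLp_two
  have hY : HasGaussianLaw (fun ω => ∑ k, z k * X k ω) P :=
    (hX.smul z).hasGaussianLaw_fun_sum (I := Finset.univ)
  have hYm : AEMeasurable (fun ω => ∑ k, z k * X k ω) P := hY.aemeasurable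
  have hYmean : ∫ ω, ∑ k, z k * X k ω ∂P = 0 := by
    rw [integral_finsetSum _ fun k _ => ((hL2 k).integrable one_le_two).const_mul _]
    simp [integral_const_mul, hmean]
  have hYvar : Var[fun ω => ∑ k, z k * X k ω; P]
      = ∑ j, ∑ k, z j * z k * ∫ ω, X j ω * X k ω ∂P := by
    rw [variance_of_integral_eq_zero hYm hYmean]
    have : ∀ ω, (∑ k, z k * X k ω) ^ 2 = ∑ j, ∑ k, z j * z k * (X j ω * X k ω) := fun ω => by
      rw [sq, Finset.sum_mul_sum]
      exact Finset.sum_congr rfl fun j _ => Finset.sum_congr rfl fun k _ => by ring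
    simp_rw [this]
    have hi : ∀ j k, Integrable (fun ω => z j * z k * (X j ω * X k ω)) P := fun j k =>
      ((hL2 j).integrable_mul (hL2 k)).const_mul _
    rw [integral_finsetSum _ fun j _ => integrable_finsetSum _ fun k _ => hi j k]
    refine Finset.sum_congr rfl fun j _ => ?_
    rw [integral_finsetSum _ fun k _ => hi j k]
    simp_rw [integral_const_mul]
  have h := hY.charFun_map_eq 1
  rw [charFun_apply_real, integral_map hYm (by fun_prop)] at h
  simp only [RCLike.inner_apply, conj_trivial, mul_one, Complex.ofReal_one, one_mul] at h
  rw [hYmean, hYvar] at h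
  rw [h]
  simp [neg_div]

/-- An element `V` of `L²` is conditionally centered Gaussian given `m`, in terms of conditional
characteristic functions integrated over the events of `m`; the conditional variance is the
conditional second moment of `V`. -/
def CondGaussian {Ω : Type*} (m : MeasurableSpace Ω) {mΩ : MeasurableSpace Ω} {P : Measure Ω}
    (V : Lp ℝ 2 P) : Prop :=
  ∀ A, MeasurableSet[m] A → ∫ ω in A, V ω ∂P = 0 ∧
    ∀ θ : ℝ, ∫ ω in A, Complex.exp ((θ * V ω : ℝ) * Complex.I) ∂P
      = ∫ ω in A, ((Real.exp (-(θ ^ 2 / 2 * P[fun ω => V ω ^ 2 | m] ω)) : ℝ) : ℂ) ∂P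

variable {Ω : Type*} {m mX mΩ : MeasurableSpace Ω} {P : Measure Ω} [IsProbabilityMeasure P]

/-- Linear combinations of a Gaussian process with random coefficients from an independent
σ-algebra are conditionally Gaussian. -/
lemma condGaussian_of_ae_eq_sum {κ : Type*} [Fintype κ] (hm : m ≤ mΩ) (hmX : mX ≤ mΩ)
    (hind : Indep m mX P) {X : κ → Ω → ℝ} (hX : IsGaussianProcess X P)
    (hXm : ∀ k, Measurable[mX] (X k)) (hmean : ∀ k, ∫ ω, X k ω ∂P = 0) {Z : κ → Ω → ℝ}
    (hZ : ∀ k, Measurable[m] (Z k)) (hZb : ∀ k, ∃ C, ∀ ω, |Z k ω| ≤ C) {V : Lp ℝ 2 P}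
    (hV : V =ᵐ[P] fun ω => ∑ k, Z k ω * X k ω) : CondGaussian m V := by
  have hL2 : ∀ k, MemLp (X k) 2 P := fun k => (hX.hasGaussianLaw_eval k).memLp_two
  have hXm' : ∀ k, Measurable (X k) := fun k => (hXm k).mono hmX le_rfl
  have hZ' : ∀ k, Measurable (Z k) := fun k => (hZ k).mono hm le_rfl
  set c : κ → κ → ℝ := fun j k => ∫ ω, X j ω * X k ω ∂P with hc
  set v : Ω → ℝ := fun ω => ∑ j, ∑ k, Z j ω * Z k ω * c j k with hv
  have hvm : Measurable[m] v :=
    Finset.measurable_fun_sum _ fun j _ => Finset.measurable_fun_sum _ fun k _ =>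
      ((hZ j).mul (hZ k)).mul_const _
  choose D hD using hZb
  have hone : ∀ A, MeasurableSet[m] A → Measurable[m] (A.indicator fun _ => (1 : ℝ)) :=
    fun A hA => measurable_const.indicator hA
  have hsplit : ∀ (Y U : Ω → ℝ), Measurable[m] Y → Measurable[mX] U →
      ∫ ω, Y ω * U ω ∂P = (∫ ω, Y ω ∂P) * ∫ ω, U ω ∂P := fun Y U hY hU => by
    have hI : IndepFun Y U P := (IndepFun_iff_Indep _ _ _).2
      (indep_of_indep_of_le_left (indep_of_indep_of_le_right hind hU.comap_le) hY.comap_le)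
    exact hI.integral_fun_mul_eq_mul_integral (hY.mono hm le_rfl).aestronglyMeasurable
      (hU.mono hmX le_rfl).aestronglyMeasurable
  have hset : ∀ A, MeasurableSet[m] A → ∀ f : Ω → ℝ,
      ∫ ω in A, f ω ∂P = ∫ ω, A.indicator (fun _ => (1 : ℝ)) ω * f ω ∂P := fun A hA f => by
    rw [← integral_indicator (hm A hA)]
    refine integral_congr_ae (Eventually.of_forall fun ω => ?_)
    by_cases h : ω ∈ A <;> simp [h]
  have hsetC : ∀ A, MeasurableSet[m] A → ∀ f : Ω → ℂ,
      ∫ ω in A, f ω ∂P = ∫ ω, ((A.indicator (fun _ => (1 : ℝ)) ω : ℝ) : ℂ) * f ω ∂P :=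
    fun A hA f => by
    rw [← integral_indicator (hm A hA)]
    refine integral_congr_ae (Eventually.of_forall fun ω => ?_)
    by_cases h : ω ∈ A <;> simp [h]
  have hZZ : ∀ j k, Integrable (fun ω => Z j ω * Z k ω * (X j ω * X k ω)) P := fun j k => by
    have := (memLp_bounded_mul (hZ' j) (hD j) (hL2 j)).integrable_mul
      (memLp_bounded_mul (hZ' k) (hD k) (hL2 k))
    exact this.congr (Eventually.of_forall fun ω => by simp only [Pi.mul_apply]; ring)
  have hZZc : ∀ j k, Integrable (fun ω => Z j ω * Z k ω * c j k) P := fun j k => by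
    refine Integrable.mul_const (Integrable.of_bound ((hZ' j).mul (hZ' k)).aestronglyMeasurable
      (D j * D k) (Eventually.of_forall fun ω => ?_)) _
    rw [Real.norm_eq_abs, Pi.mul_apply, abs_mul]
    exact mul_le_mul (hD j ω) (hD k ω) (abs_nonneg _) ((abs_nonneg _).trans (hD j ω))
  have hvi : Integrable v P :=
    integrable_finsetSum _ fun j _ => integrable_finsetSum _ fun k _ => hZZc j k
  -- the conditional second moment of `V` is the quadratic form `v`
  have hcond : v =ᵐ[P] P[fun ω => V ω ^ 2 | m] := by
    refine ae_eq_condExp_of_forall_setIntegral_eq hm (Lp.memLp V).integrable_sq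
      (fun A _ _ => hvi.integrableOn) (fun A hA _ => ?_) hvm.stronglyMeasurable.aestronglyMeasurable
    have h1 : ∀ᵐ ω ∂P, V ω ^ 2 = ∑ j, ∑ k, Z j ω * Z k ω * (X j ω * X k ω) := by
      filter_upwards [hV] with ω hω
      rw [hω, sq, Finset.sum_mul_sum]
      exact Finset.sum_congr rfl fun j _ => Finset.sum_congr rfl fun k _ => by ring
    have hterm : ∀ j k, ∫ ω in A, Z j ω * Z k ω * c j k ∂P
        = ∫ ω in A, Z j ω * Z k ω * (X j ω * X k ω) ∂P := fun j k => by
      have := hsplit (fun ω => A.indicator (fun _ => (1 : ℝ)) ω * (Z j ω * Z k ω))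
        (fun ω => X j ω * X k ω) ((hone A hA).mul ((hZ j).mul (hZ k))) ((hXm j).mul (hXm k))
      rw [integral_mul_const, hset A hA, ← this, hset A hA]
      exact integral_congr_ae (Eventually.of_forall fun ω => by ring)
    rw [integral_congr_ae (ae_restrict_of_ae h1),
      integral_finsetSum _ fun j _ => integrable_finsetSum _ fun k _ => (hZZ j k).integrableOn,
      integral_finsetSum _ fun j _ => integrable_finsetSum _ fun k _ => (hZZc j k).integrableOn]
    refine Finset.sum_congr rfl fun j _ => ?_
    rw [integral_finsetSum _ fun k _ => (hZZ j k).integrableOn,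
      integral_finsetSum _ fun k _ => (hZZc j k).integrableOn]
    exact Finset.sum_congr rfl fun k _ => hterm j k
  intro A hA
  refine ⟨?_, fun θ => ?_⟩
  · rw [integral_congr_ae (ae_restrict_of_ae hV), integral_finsetSum _ fun k _ =>
      ((memLp_bounded_mul (hZ' k) (hD k) (hL2 k)).integrable one_le_two).integrableOn]
    refine Finset.sum_eq_zero fun k _ => ?_
    have := hsplit (fun ω => A.indicator (fun _ => (1 : ℝ)) ω * Z k ω) (X k)
      ((hone A hA).mul (hZ k)) (hXm k)
    rw [hmean, mul_zero] at this
    rw [hset A hA, ← this]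
    simp only [mul_assoc]
  · have e1 : ∫ ω in A, Complex.exp ((θ * V ω : ℝ) * Complex.I) ∂P
        = ∫ ω, ((A.indicator (fun _ => (1 : ℝ)) ω : ℝ) : ℂ) *
          Complex.exp ((∑ k, (θ * Z k ω) * X k ω : ℝ) * Complex.I) ∂P := by
      rw [hsetC A hA]
      refine integral_congr_ae ?_
      filter_upwards [hV] with ω hω
      rw [hω, Finset.mul_sum]
      simp only [mul_assoc]
    have e2 : ∫ ω in A, ((Real.exp (-(θ ^ 2 / 2 * P[fun ω => V ω ^ 2 | m] ω)) : ℝ) : ℂ) ∂P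
        = ∫ ω, ((A.indicator (fun _ => (1 : ℝ)) ω : ℝ) : ℂ) *
          Complex.exp (-(∑ j, ∑ k, (θ * Z j ω) * (θ * Z k ω) * c j k : ℝ) / 2) ∂P := by
      rw [hsetC A hA]
      refine integral_congr_ae ?_
      filter_upwards [hcond] with ω hω
      have h1 : ∑ j, ∑ k, (θ * Z j ω) * (θ * Z k ω) * c j k = θ ^ 2 * v ω := by
        simp only [hv, Finset.mul_sum]
        exact Finset.sum_congr rfl fun j _ => Finset.sum_congr rfl fun k _ => by ring
      rw [← hω, h1, Complex.ofReal_exp]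
      congr 2
      push_cast
      ring
    rw [e1, e2]
    -- the coefficients and the Gaussian vector have a product law
    set ζ : Ω → ℝ × (κ → ℝ) := fun ω => (A.indicator (fun _ => (1 : ℝ)) ω, fun k => θ * Z k ω)
      with hζ
    set ξ : Ω → κ → ℝ := fun ω k => X k ω with hξ
    have hζm : Measurable[m] ζ :=
      (hone A hA).prodMk (@measurable_pi_lambda Ω κ (fun _ => ℝ) m _ _ fun k => (hZ k).const_mul θ)
    have hξm : Measurable[mX] ξ := @measurable_pi_lambda Ω κ (fun _ => ℝ) mX _ _ fun k => hXm k
    have hζm' : Measurable ζ := hζm.mono hm le_rfl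
    have hξm' : Measurable ξ := hξm.mono hmX le_rfl
    have hI : IndepFun ζ ξ P := (IndepFun_iff_Indep _ _ _).2
      (indep_of_indep_of_le_left (indep_of_indep_of_le_right hind hξm.comap_le) hζm.comap_le)
    have hprod := (indepFun_iff_map_prod_eq_prod_map_map hζm'.aemeasurable hξm'.aemeasurable).1 hI
    set F : (ℝ × (κ → ℝ)) × (κ → ℝ) → ℂ := fun q =>
      (q.1.1 : ℂ) * Complex.exp ((∑ k, q.1.2 k * q.2 k : ℝ) * Complex.I) with hF
    have hFm : Measurable F := by
      have : Measurable fun q : (ℝ × (κ → ℝ)) × (κ → ℝ) => ∑ k, q.1.2 k * q.2 k := by fun_prop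
      fun_prop
    have hFi : Integrable F (P.map fun ω => (ζ ω, ξ ω)) := by
      rw [integrable_map_measure hFm.aestronglyMeasurable (hζm'.prodMk hξm').aemeasurable]
      refine Integrable.of_bound (hFm.comp (hζm'.prodMk hξm')).aestronglyMeasurable 1
        (Eventually.of_forall fun ω => ?_)
      simp only [Function.comp, hF, norm_mul, Complex.norm_exp_ofReal_mul_I, mul_one, hζ]
      by_cases h : ω ∈ A <;> simp [h]
    calc _ = ∫ q, F q ∂(P.map fun ω => (ζ ω, ξ ω)) := by
          rw [integral_map (hζm'.prodMk hξm').aemeasurable hFm.aestronglyMeasurable]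
      _ = ∫ z, ∫ x, F (z, x) ∂(P.map ξ) ∂(P.map ζ) := by
          rw [hprod] at hFi ⊢
          exact integral_prod _ hFi
      _ = ∫ z, (z.1 : ℂ) * Complex.exp (-(∑ j, ∑ k, z.2 j * z.2 k * c j k : ℝ) / 2) ∂(P.map ζ) := by
          refine integral_congr_ae (Eventually.of_forall fun z => ?_)
          simp only [hF]
          rw [integral_const_mul, integral_map hξm'.aemeasurable,
            integral_cexp_sum_of_isGaussianProcess hX hmean]
          have h1 : Measurable fun x : κ → ℝ => ∑ k, z.2 k * x k := by fun_prop
          have h2 : Measurable fun x : κ → ℝ =>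
            Complex.exp ((∑ k, z.2 k * x k : ℝ) * Complex.I) := by fun_prop
          exact h2.aestronglyMeasurable
      _ = _ := by
          have h1 : Measurable fun z : ℝ × (κ → ℝ) => ∑ j, ∑ k, z.2 j * z.2 k * c j k := by
            fun_prop
          have h2 : Measurable fun z : ℝ × (κ → ℝ) => (z.1 : ℂ) *
            Complex.exp (-(∑ j, ∑ k, z.2 j * z.2 k * c j k : ℝ) / 2) := by fun_prop
          rw [integral_map hζm'.aemeasurable h2.aestronglyMeasurable]

end

/-! ### Stability of conditional Gaussianity and the conditional law -/

section

/-! ### Stability of conditional Gaussianity and the conditional law -/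

variable {Ω : Type*} {m mX mΩ : MeasurableSpace Ω} {P : Measure Ω}

lemma tendsto_setIntegral_of_norm_sub_le {G : Type*} [NormedAddCommGroup G] [NormedSpace ℝ G]
    {f : ℕ → Ω → ℝ} {g : Ω → ℝ} (hfg : Tendsto (fun n => eLpNorm (f n - g) 1 P) atTop (𝓝 0))
    {F : ℕ → Ω → G} {K : Ω → G} (hF : ∀ n, Integrable (F n) P) (hK : AEStronglyMeasurable K P)
    (C : ℝ) (h : ∀ n, ∀ᵐ ω ∂P, ‖F n ω - K ω‖ ≤ C * |f n ω - g ω|) (A : Set Ω) :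
    Tendsto (fun n => ∫ ω in A, F n ω ∂P) atTop (𝓝 (∫ ω in A, K ω ∂P)) := by
  refine tendsto_setIntegral_of_L1' K hK (Eventually.of_forall hF) ?_ A
  have h0 : Tendsto (fun n => ENNReal.ofReal C * eLpNorm (f n - g) 1 P) atTop (𝓝 0) := by
    simpa using ENNReal.Tendsto.const_mul hfg (Or.inr ENNReal.ofReal_ne_top)
  exact tendsto_of_tendsto_of_tendsto_of_le_of_le tendsto_const_nhds h0 (fun n => zero_le)
    fun n => eLpNorm_le_mul_eLpNorm_of_ae_le_mul (h n) 1

lemma norm_cexp_mul_I_sub_le (a b : ℝ) :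
    ‖Complex.exp (a * Complex.I) - Complex.exp (b * Complex.I)‖ ≤ |a - b| := by
  have h1 : Complex.exp (a * Complex.I) - Complex.exp (b * Complex.I)
      = Complex.exp (b * Complex.I) * (Complex.exp (Complex.I * (a - b : ℝ)) - 1) := by
    rw [mul_sub, ← Complex.exp_add, mul_one]
    congr 2
    push_cast
    ring
  rw [h1, norm_mul, Complex.norm_exp_ofReal_mul_I, one_mul]
  exact Real.norm_exp_I_mul_ofReal_sub_one_le

lemma abs_exp_neg_sub_exp_neg_le {a b : ℝ} (ha : 0 ≤ a) (hb : 0 ≤ b) :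
    |Real.exp (-a) - Real.exp (-b)| ≤ |a - b| := by
  wlog hab : a ≤ b generalizing a b
  · rw [abs_sub_comm, abs_sub_comm a]
    exact this hb ha (le_of_not_ge hab)
  have h1 : Real.exp (-b) ≤ Real.exp (-a) := Real.exp_le_exp.2 (by linarith)
  rw [abs_of_nonneg (by linarith), abs_sub_comm, abs_of_nonneg (by linarith)]
  have h2 : Real.exp (-b) = Real.exp (-a) * Real.exp (-(b - a)) := by
    rw [← Real.exp_add]; ring_nf
  have h3 := Real.add_one_le_exp (-(b - a))
  have h4 : Real.exp (-a) ≤ 1 := Real.exp_le_one_iff.2 (by linarith)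
  have h5 := Real.exp_pos (-a)
  rw [h2]
  nlinarith [mul_nonneg h5.le (show 0 ≤ Real.exp (-(b - a)) - (-(b - a) + 1) by linarith)]

lemma tendsto_eLpNorm_sub_one [IsProbabilityMeasure P] {V : ℕ → Lp ℝ 2 P} {U : Lp ℝ 2 P}
    (h : Tendsto V atTop (𝓝 U)) :
    Tendsto (fun n => eLpNorm ((V n : Ω → ℝ) - (U : Ω → ℝ)) 1 P) atTop (𝓝 0) := by
  have h2 := (Lp.tendsto_Lp_iff_tendsto_eLpNorm' V U).1 h
  exact tendsto_of_tendsto_of_tendsto_of_le_of_le tendsto_const_nhds h2 (fun n => zero_le)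
    fun n => eLpNorm_le_eLpNorm_of_exponent_le one_le_two
      ((Lp.aestronglyMeasurable _).sub (Lp.aestronglyMeasurable _))

lemma tendsto_eLpNorm_sq_sub_sq {V : ℕ → Lp ℝ 2 P} {U : Lp ℝ 2 P} (h : Tendsto V atTop (𝓝 U)) :
    Tendsto (fun n => eLpNorm ((fun ω => V n ω ^ 2) - fun ω => U ω ^ 2) 1 P) atTop (𝓝 0) := by
  have h1 : Tendsto (fun n => ‖V n - U‖ₑ * ‖V n + U‖ₑ) atTop (𝓝 0) := by
    have ha : Tendsto (fun n => ‖V n - U‖ₑ) atTop (𝓝 0) := by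
      have := (h.sub_const U).enorm
      simpa using this
    have hb : Tendsto (fun n => ‖V n + U‖ₑ) atTop (𝓝 ‖U + U‖ₑ) := (h.add_const U).enorm
    have := ENNReal.Tendsto.mul ha (Or.inr enorm_ne_top) hb (Or.inr ENNReal.zero_ne_top)
    rwa [zero_mul] at this
  refine tendsto_of_tendsto_of_tendsto_of_le_of_le tendsto_const_nhds h1 (fun n => zero_le)
    fun n => ?_
  have h2 : ((fun ω => V n ω ^ 2) - fun ω => U ω ^ 2) =ᵐ[P]
      ((V n - U : Lp ℝ 2 P) : Ω → ℝ) • ((V n + U : Lp ℝ 2 P) : Ω → ℝ) := by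
    filter_upwards [Lp.coeFn_sub (V n) U, Lp.coeFn_add (V n) U] with ω h3 h4
    simp only [Pi.sub_apply, Pi.smul_apply', smul_eq_mul, h3, h4, Pi.add_apply]
    ring
  simp only
  rw [eLpNorm_congr_ae h2, Lp.enorm_def, Lp.enorm_def]
  exact eLpNorm_smul_le_mul_eLpNorm (Lp.aestronglyMeasurable _) (Lp.aestronglyMeasurable _)

lemma tendsto_eLpNorm_condExp_sq {V : ℕ → Lp ℝ 2 P} {U : Lp ℝ 2 P}
    (h : Tendsto V atTop (𝓝 U)) :
    Tendsto (fun n => eLpNorm (P[fun ω => V n ω ^ 2 | m] - P[fun ω => U ω ^ 2 | m]) 1 P) atTop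
      (𝓝 0) := by
  refine tendsto_of_tendsto_of_tendsto_of_le_of_le tendsto_const_nhds
    (tendsto_eLpNorm_sq_sub_sq h) (fun n => zero_le) fun n => ?_
  simp only
  rw [← eLpNorm_congr_ae (condExp_sub (Lp.memLp (V n)).integrable_sq (Lp.memLp U).integrable_sq m)]
  exact eLpNorm_condExp_le_eLpNorm _ le_rfl

/-- Conditionally Gaussian elements form a closed subset of `L²`. -/
lemma isClosed_condGaussian [IsProbabilityMeasure P] (hm : m ≤ mΩ) :
    IsClosed {V : Lp ℝ 2 P | CondGaussian m V} := by
  refine IsSeqClosed.isClosed fun V U hV hVU A hA => ⟨?_, fun θ => ?_⟩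
  · have h1 := tendsto_setIntegral_of_norm_sub_le (tendsto_eLpNorm_sub_one hVU)
      (F := fun n => V n) (K := U) (fun n => (Lp.memLp (V n)).integrable one_le_two)
      (Lp.aestronglyMeasurable _) 1 (fun n => Eventually.of_forall fun ω => by
        rw [one_mul, Real.norm_eq_abs]) A
    exact tendsto_nhds_unique h1 (by simp [(hV _ A hA).1])
  · have hmeas : ∀ W : Lp ℝ 2 P, AEStronglyMeasurable
        (fun ω => Complex.exp ((θ * W ω : ℝ) * Complex.I)) P := fun W => by
      have : Continuous fun x : ℝ => Complex.exp ((θ * x : ℝ) * Complex.I) := by fun_prop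
      exact this.comp_aestronglyMeasurable (Lp.aestronglyMeasurable W)
    have hmeas' : ∀ W : Lp ℝ 2 P, AEStronglyMeasurable
        (fun ω => ((Real.exp (-(θ ^ 2 / 2 * P[fun ω => W ω ^ 2 | m] ω)) : ℝ) : ℂ)) P := fun W => by
      have : Continuous fun x : ℝ => ((Real.exp (-(θ ^ 2 / 2 * x)) : ℝ) : ℂ) := by fun_prop
      exact this.comp_aestronglyMeasurable (stronglyMeasurable_condExp.mono hm).aestronglyMeasurable
    have hpos : ∀ W : Lp ℝ 2 P, 0 ≤ᵐ[P] P[fun ω => W ω ^ 2 | m] := fun W =>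
      condExp_nonneg (Eventually.of_forall fun ω => sq_nonneg _)
    have h1 := tendsto_setIntegral_of_norm_sub_le (tendsto_eLpNorm_sub_one hVU)
      (F := fun n ω => Complex.exp ((θ * V n ω : ℝ) * Complex.I))
      (K := fun ω => Complex.exp ((θ * U ω : ℝ) * Complex.I))
      (fun n => Integrable.of_bound (hmeas _) 1 (Eventually.of_forall fun ω => by
        rw [Complex.norm_exp_ofReal_mul_I])) (hmeas _) |θ|
      (fun n => Eventually.of_forall fun ω => (norm_cexp_mul_I_sub_le _ _).trans_eq (by
        rw [← mul_sub, abs_mul])) A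
    have h2 := tendsto_setIntegral_of_norm_sub_le (tendsto_eLpNorm_condExp_sq hVU)
      (F := fun n ω => ((Real.exp (-(θ ^ 2 / 2 * P[fun ω => V n ω ^ 2 | m] ω)) : ℝ) : ℂ))
      (K := fun ω => ((Real.exp (-(θ ^ 2 / 2 * P[fun ω => U ω ^ 2 | m] ω)) : ℝ) : ℂ))
      (fun n => Integrable.of_bound (hmeas' _) 1 (by
        filter_upwards [hpos (V n)] with ω hω
        rw [Complex.norm_real, Real.norm_of_nonneg (Real.exp_pos _).le, Real.exp_le_one_iff]
        have : 0 ≤ θ ^ 2 / 2 * P[fun ω => V n ω ^ 2 | m] ω := mul_nonneg (by positivity) hω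
        linarith)) (hmeas' _) (θ ^ 2 / 2)
      (fun n => by
        filter_upwards [hpos (V n), hpos U] with ω hω hω'
        rw [← Complex.ofReal_sub, Complex.norm_real, Real.norm_eq_abs]
        refine (abs_exp_neg_sub_exp_neg_le (mul_nonneg (by positivity) hω)
          (mul_nonneg (by positivity) hω')).trans_eq ?_
        rw [← mul_sub, abs_mul, abs_of_nonneg (by positivity)]) A
    refine tendsto_nhds_unique h1 (h2.congr fun n => ?_)
    exact ((hV n A hA).2 θ).symm

/-- The closed span in `L²` of the products of a process `X` with bounded `m`-measurable
coefficients. -/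
noncomputable def closedSpan {Ω ι : Type*} (m : MeasurableSpace Ω) {mΩ : MeasurableSpace Ω}
    (P : Measure Ω) (X : ι → Ω → ℝ) : Submodule ℝ (Lp ℝ 2 P) :=
  (Submodule.span ℝ (range fun q : {Z : Ω → ℝ // Measurable[m] Z ∧ ∃ C, ∀ ω, |Z ω| ≤ C} × ι =>
    toL2 P fun ω => q.1.1 ω * X q.2 ω)).topologicalClosure

lemma toL2_mul_mem_closedSpan {ι : Type*} (X : ι → Ω → ℝ) {Z : Ω → ℝ} (hZ : Measurable[m] Z)
    {C : ℝ} (hC : ∀ ω, |Z ω| ≤ C) (i : ι) :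
    toL2 P (fun ω => Z ω * X i ω) ∈ closedSpan m P X :=
  Submodule.le_topologicalClosure _ (Submodule.subset_span ⟨(⟨Z, hZ, C, hC⟩, i), rfl⟩)

/-- The closed span of an independent centered Gaussian process over `m` consists of conditionally
Gaussian elements. -/
lemma condGaussian_of_mem_closedSpan [IsProbabilityMeasure P] (hm : m ≤ mΩ) (hmX : mX ≤ mΩ)
    (hind : Indep m mX P)
    {ι : Type*} {X : ι → Ω → ℝ} (hX : IsGaussianProcess X P) (hXm : ∀ i, Measurable[mX] (X i))
    (hmean : ∀ i, ∫ ω, X i ω ∂P = 0) {V : Lp ℝ 2 P} (hV : V ∈ closedSpan m P X) :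
    CondGaussian m V := by
  suffices h : ((Submodule.span ℝ (range fun q : {Z : Ω → ℝ // Measurable[m] Z ∧
      ∃ C, ∀ ω, |Z ω| ≤ C} × ι => toL2 P fun ω => q.1.1 ω * X q.2 ω) : Submodule ℝ (Lp ℝ 2 P)) :
      Set (Lp ℝ 2 P)) ⊆ {V | CondGaussian m V} from
    closure_minimal h (isClosed_condGaussian hm) hV
  intro V hV
  obtain ⟨a, rfl⟩ := Finsupp.mem_span_range_iff_exists_finsupp.1 hV
  have hL2 : ∀ q : {Z : Ω → ℝ // Measurable[m] Z ∧ ∃ C, ∀ ω, |Z ω| ≤ C} × ι,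
      MemLp (fun ω => q.1.1 ω * X q.2 ω) 2 P := fun q => by
    obtain ⟨C, hC⟩ := q.1.2.2
    exact memLp_bounded_mul (q.1.2.1.mono hm le_rfl) hC (hX.hasGaussianLaw_eval _).memLp_two
  refine condGaussian_of_ae_eq_sum (κ := a.support) hm hmX hind
    (X := fun q => X q.1.2) (hX.comp_right fun q : a.support => q.1.2) (fun q => hXm _)
    (fun q => hmean _) (Z := fun q ω => a q.1 * q.1.1.1 ω) (fun q => q.1.1.2.1.const_mul _)
    (fun q => ?_) ?_
  · obtain ⟨C, hC⟩ := q.1.1.2.2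
    refine ⟨|a q.1| * C, fun ω => ?_⟩
    rw [abs_mul]
    exact mul_le_mul_of_nonneg_left (hC ω) (abs_nonneg _)
  · have h1 : ∀ᵐ ω ∂P, ∀ q : a.support, (a q.1 • toL2 P fun ω => q.1.1.1 ω * X q.1.2 ω) ω
        = a q.1 * q.1.1.1 ω * X q.1.2 ω := by
      rw [ae_all_iff]
      intro q
      filter_upwards [Lp.coeFn_smul (a q.1) (toL2 P fun ω => q.1.1.1 ω * X q.1.2 ω),
        coeFn_toL2 (hL2 q.1)] with ω h1 h2
      rw [h1, Pi.smul_apply, h2, smul_eq_mul, mul_assoc]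
    rw [Finsupp.sum, ← Finset.sum_coe_sort]
    filter_upwards [h1, Lp.coeFn_finsetSum Finset.univ
      (fun q : a.support => a q.1 • toL2 P fun ω => q.1.1.1 ω * X q.1.2 ω)] with ω h2 h3
    rw [h3, Finset.sum_apply]
    exact Finset.sum_congr rfl fun q _ => h2 q

/-- Bochner integrals of functions with values in a closed subspace stay in the subspace. -/
lemma integral_mem_of_forall_mem {α E : Type*} [MeasurableSpace α] {μ : Measure α}
    [NormedAddCommGroup E] [InnerProductSpace ℝ E] [CompleteSpace E] {M : Submodule ℝ E}
    (hM : IsClosed (M : Set E)) {f : α → E} (hf : ∀ᵐ x ∂μ, f x ∈ M) : ∫ x, f x ∂μ ∈ M := by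
  by_cases hi : Integrable f μ
  swap
  · rw [integral_undef hi]; exact M.zero_mem
  have : CompleteSpace M := hM.completeSpace_coe
  have h1 := M.starProjection.integral_comp_comm hi
  have h2 : ∫ x, M.starProjection (f x) ∂μ = ∫ x, f x ∂μ := by
    refine integral_congr_ae ?_
    filter_upwards [hf] with x hx using Submodule.starProjection_eq_self_iff.2 hx
  rw [← h2, h1]
  exact Submodule.starProjection_apply_mem _ _

/-- The centered Gaussian law with variance `v⁺` as an image of the standard one. -/
lemma map_sqrt_mul_gaussianReal (v : ℝ) :
    (gaussianReal 0 1).map (fun x => √v * x) = gaussianReal 0 v.toNNReal := by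
  rw [gaussianReal_map_const_mul, mul_zero, mul_one]
  congr 1
  ext
  simp only [NNReal.coe_mk, Real.coe_toNNReal']
  rcases le_total 0 v with h | h
  · rw [Real.sq_sqrt h, max_eq_left h]
  · rw [Real.sqrt_eq_zero_of_nonpos h, max_eq_right h]; simp

lemma gaussianReal_apply_eq_preimage {S : Set ℝ} (hS : MeasurableSet S) (v : ℝ) :
    gaussianReal 0 v.toNNReal S = gaussianReal 0 1 ((fun x => √v * x) ⁻¹' S) := by
  rw [← map_sqrt_mul_gaussianReal, Measure.map_apply (by fun_prop) hS]

lemma measurable_gaussianReal_real {Ω : Type*} {m : MeasurableSpace Ω} {v : Ω → ℝ}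
    (hv : Measurable v) {S : Set ℝ} (hS : MeasurableSet S) :
    Measurable fun ω => (gaussianReal 0 (v ω).toNNReal).real S := by
  have h1 : MeasurableSet ((fun z : Ω × ℝ => √(v z.1) * z.2) ⁻¹' S) := by
    have : Measurable fun z : Ω × ℝ => √(v z.1) * z.2 := by fun_prop
    exact this hS
  have h2 := (measurable_measure_prodMk_left (ν := gaussianReal 0 1) h1).ennreal_toReal
  have h3 : (fun ω => (gaussianReal 0 (v ω).toNNReal).real S) = fun ω =>
      (gaussianReal 0 1 (Prod.mk ω ⁻¹' ((fun z : Ω × ℝ => √(v z.1) * z.2) ⁻¹' S))).toReal := by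
    funext ω
    rw [measureReal_def, gaussianReal_apply_eq_preimage hS]
    rfl
  rw [h3]
  exact h2

/-- Conditional characteristic functions determine the conditional law. -/
lemma CondGaussian.isCondCenteredGaussian [IsProbabilityMeasure P] (hm : m ≤ mΩ)
    {V : Lp ℝ 2 P} (hV : CondGaussian m V)
    {v : Ω → ℝ} (hv : v =ᵐ[P] P[fun ω => V ω ^ 2 | m]) : IsCondCenteredGaussian P m V v := by
  set w : Ω → ℝ := P[fun ω => V ω ^ 2 | m] with hw
  have hwm : Measurable[m] w := stronglyMeasurable_condExp.measurable
  have hwm' : Measurable w := hwm.mono hm le_rfl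
  have hw0 : 0 ≤ᵐ[P] w := condExp_nonneg (Eventually.of_forall fun ω => sq_nonneg _)
  have hVm : AEMeasurable V P := (Lp.aestronglyMeasurable V).aemeasurable
  refine ⟨by filter_upwards [hv, hw0] with ω h1 h2; rw [h1]; exact h2, fun S hS => ?_⟩
  have hg : (fun ω => (gaussianReal 0 (w ω).toNNReal).real S)
      =ᵐ[P] fun ω => (gaussianReal 0 (v ω).toNNReal).real S := by
    filter_upwards [hv] with ω h1
    rw [h1]
  refine EventuallyEq.trans (EventuallyEq.symm ?_) hg
  have hgm := measurable_gaussianReal_real hwm hS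
  have hgi : Integrable (fun ω => (gaussianReal 0 (w ω).toNNReal).real S) P :=
    Integrable.of_bound (hgm.mono hm le_rfl).aestronglyMeasurable 1
      (Eventually.of_forall fun ω => by
        rw [Real.norm_of_nonneg measureReal_nonneg]; exact measureReal_le_one)
  have hSm : NullMeasurableSet (V ⁻¹' S) P := hVm.nullMeasurable hS
  have hSi : Integrable ((V ⁻¹' S).indicator fun _ => (1 : ℝ)) P :=
    (integrable_const (1 : ℝ)).indicator₀ hSm
  refine ae_eq_condExp_of_forall_setIntegral_eq hm hSi (fun A _ _ => hgi.integrableOn)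
    (fun A hA _ => ?_) hgm.stronglyMeasurable.aestronglyMeasurable
  -- the two laws on the event `A` agree because their characteristic functions do
  have hpm : Measurable fun z : Ω × ℝ => √(w z.1) * z.2 := by fun_prop
  have hlaw : (P.restrict A).map V
      = ((P.restrict A).prod (gaussianReal 0 1)).map fun z => √(w z.1) * z.2 := by
    refine Measure.ext_of_charFun (funext fun θ => ?_)
    rw [charFun_apply_real, charFun_apply_real, integral_map hVm.restrict (by fun_prop),
      integral_map hpm.aemeasurable (by fun_prop), integral_prod]
    · have h1 := (hV A hA).2 θ
      push_cast at h1
      rw [h1]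
      refine integral_congr_ae (ae_restrict_of_ae ?_)
      filter_upwards [hw0] with ω hω
      have h2 := charFun_gaussianReal (μ := 0) (v := 1) (θ * √(w ω))
      rw [charFun_apply_real] at h2
      simp only [Complex.ofReal_mul, ← mul_assoc] at h2 ⊢
      rw [h2]
      have h3 : ((√(w ω) : ℝ) : ℂ) ^ 2 = (w ω : ℂ) := by
        rw [← Complex.ofReal_pow, Real.sq_sqrt hω]
      congr 1
      simp only [Complex.ofReal_zero, mul_zero, zero_mul, zero_sub, NNReal.coe_one,
        Complex.ofReal_one, one_mul, mul_pow, h3]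
      ring
    · have h2 : Measurable fun z : Ω × ℝ =>
          Complex.exp (θ * ((√(w z.1) * z.2 : ℝ) : ℂ) * Complex.I) := by fun_prop
      refine Integrable.of_bound h2.aestronglyMeasurable 1 (Eventually.of_forall fun z => ?_)
      rw [← Complex.ofReal_mul, Complex.norm_exp_ofReal_mul_I]
  have h1 : ((P.restrict A).map V) S
      = ((P.restrict A).prod (gaussianReal 0 1)) ((fun z => √(w z.1) * z.2) ⁻¹' S) := by
    rw [hlaw, Measure.map_apply hpm hS]
  rw [Measure.map_apply_of_aemeasurable hVm.restrict hS, Measure.prod_apply (hpm hS)] at h1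
  have h2 : ∫ ω in A, (V ⁻¹' S).indicator (fun _ => (1 : ℝ)) ω ∂P
      = ((P.restrict A) (V ⁻¹' S)).toReal := by
    have hSm' : NullMeasurableSet (V ⁻¹' S) (P.restrict A) := hSm.mono_ac
      Measure.absolutelyContinuous_restrict
    rw [integral_indicator₀ hSm', setIntegral_const, smul_eq_mul, mul_one, measureReal_def]
  rw [h2, h1, ← integral_toReal]
  · refine integral_congr_ae (Eventually.of_forall fun ω => ?_)
    simp only
    rw [measureReal_def, gaussianReal_apply_eq_preimage hS]
    rfl
  · exact (measurable_measure_prodMk_left (hpm hS)).aemeasurable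
  · exact Eventually.of_forall fun ω => measure_lt_top _ _

lemma CondGaussian.condVar_ae_eq [IsProbabilityMeasure P] (hm : m ≤ mΩ)
    {V : Lp ℝ 2 P} (hV : CondGaussian m V) :
    condVar m V P =ᵐ[P] P[fun ω => V ω ^ 2 | m] := by
  have h0 : P[V | m] =ᵐ[P] 0 := by
    refine (ae_eq_condExp_of_forall_setIntegral_eq hm ((Lp.memLp V).integrable one_le_two)
      (fun A _ _ => integrableOn_zero) (fun A hA _ => ?_)
      stronglyMeasurable_zero.aestronglyMeasurable).symm
    rw [(hV A hA).1]
    simp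
  filter_upwards [condVar_ae_eq_condExp_sq_sub_sq_condExp hm (Lp.memLp V), h0] with ω h1 h2
  rw [h1, Pi.sub_apply, Pi.pow_apply, h2, Pi.zero_apply, zero_pow two_ne_zero, sub_zero]
  rfl

end

/-! ### The regularized noise in `L²` -/

section

/-- A map into an inner product space is continuous as soon as its Gram kernel is. -/
lemma continuousOn_of_continuousOn_inner {X E : Type*} [TopologicalSpace X]
    [NormedAddCommGroup E] [InnerProductSpace ℝ E] {S : Set X} {f : X → E}
    (h : ContinuousOn (fun p : X × X => inner ℝ (f p.1) (f p.2)) (S ×ˢ S)) :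
    ContinuousOn f S := by
  intro x hx
  have h1 : ContinuousWithinAt (fun y => inner ℝ (f y) (f y)) S x :=
    ContinuousWithinAt.comp (f := fun y => (y, y)) (h (x, x) ⟨hx, hx⟩)
      (by fun_prop) fun y hy => ⟨hy, hy⟩
  have h2 : ContinuousWithinAt (fun y => inner ℝ (f y) (f x)) S x :=
    ContinuousWithinAt.comp (f := fun y => (y, x)) (h (x, x) ⟨hx, hx⟩)
      (by fun_prop) fun y hy => ⟨hy, hx⟩
  have h3 : Tendsto (fun y => ‖f y - f x‖ ^ 2) (𝓝[S] x) (𝓝 0) := by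
    have h4 := (h1.tendsto.sub (h2.tendsto.const_mul 2)).add_const (inner ℝ (f x) (f x))
    rw [show inner ℝ (f x) (f x) - 2 * inner ℝ (f x) (f x) + inner ℝ (f x) (f x) = (0 : ℝ) by
      ring] at h4
    refine h4.congr fun y => ?_
    rw [norm_sub_sq_real, real_inner_self_eq_norm_sq, real_inner_self_eq_norm_sq]
  rw [ContinuousWithinAt, tendsto_iff_norm_sub_tendsto_zero]
  have h5 := h3.sqrt
  simpa [Real.sqrt_sq] using h5

lemma inner_integral_integral {α β E : Type*} [MeasurableSpace α] [MeasurableSpace β]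
    {μ : Measure α} {ν : Measure β} [SFinite μ] [SFinite ν] [NormedAddCommGroup E]
    [InnerProductSpace ℝ E] [CompleteSpace E] {f : α → E} {g : β → E} (hf : Integrable f μ)
    (hg : Integrable g ν) :
    Integrable (fun p : α × β => inner ℝ (f p.1) (g p.2)) (μ.prod ν) ∧
    inner ℝ (∫ x, f x ∂μ) (∫ y, g y ∂ν) = ∫ p, inner ℝ (f p.1) (g p.2) ∂(μ.prod ν) := by
  have hi : Integrable (fun p : α × β => inner ℝ (f p.1) (g p.2)) (μ.prod ν) := by
    refine (hf.norm.mul_prod hg.norm).mono'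
      (hf.aestronglyMeasurable.comp_fst.inner hg.aestronglyMeasurable.comp_snd)
      (Eventually.of_forall fun p => norm_inner_le_norm _ _)
  refine ⟨hi, ?_⟩
  rw [integral_prod _ hi]
  simp_rw [integral_inner hg, real_inner_comm (∫ y, g y ∂ν)]
  rw [integral_inner hf]

/-- Restriction of square integrable random variables to an event. -/
noncomputable abbrev restrictL2 {Ω : Type*} [MeasurableSpace Ω] (P : Measure Ω) (A : Set Ω) :
    Lp ℝ 2 P →L[ℝ] Lp ℝ 2 (P.restrict A) :=
  LpToLpRestrictCLM Ω ℝ ℝ P 2 A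

variable {Ω : Type*} [mΩ : MeasurableSpace Ω] {P : Measure Ω}

lemma inner_restrictL2 (A : Set Ω) (U V : Lp ℝ 2 P) :
    inner ℝ (restrictL2 P A U) (restrictL2 P A V) = ∫ ω in A, U ω * V ω ∂P := by
  rw [L2.inner_def]
  refine integral_congr_ae ?_
  filter_upwards [LpToLpRestrictCLM_coeFn ℝ A U, LpToLpRestrictCLM_coeFn ℝ A V] with ω h1 h2
  rw [h1, h2, RCLike.inner_apply, conj_trivial, mul_comm]

variable {d : ℕ} {T : ℝ} {H : Fin (d + 1) → ℝ} {ρ : EuclideanSpace ℝ (Fin d) → ℝ}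
  {W : ℝ → EuclideanSpace ℝ (Fin d) → Ω → ℝ} {B : ℝ → Ω → EuclideanSpace ℝ (Fin d)}

lemma IsWeightedFracBrownianField.sigmaW_le (hW : IsWeightedFracBrownianField H ρ W P) :
    sigmaW W ≤ mΩ :=
  iSup_le fun p => (hW.measurable p.1 p.1.2 p.2).comap_le

lemma measurable_sigmaW {Ω : Type*} {W : ℝ → EuclideanSpace ℝ (Fin d) → Ω → ℝ} {s : ℝ}
    (hs : 0 ≤ s) (y : EuclideanSpace ℝ (Fin d)) : Measurable[sigmaW W] (W s y) :=
  Measurable.mono (comap_measurable (W s y))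
    (le_iSup (fun p : Set.Ici (0 : ℝ) × EuclideanSpace ℝ (Fin d) =>
      MeasurableSpace.comap (W p.1 p.2) inferInstance) (⟨s, hs⟩, y)) le_rfl

lemma IsWeightedFracBrownianField.memLp (hW : IsWeightedFracBrownianField H ρ W P) {s : ℝ}
    (hs : 0 ≤ s) (y : EuclideanSpace ℝ (Fin d)) : MemLp (W s y) 2 P :=
  (hW.gaussian.hasGaussianLaw_eval (⟨s, hs⟩, y)).memLp_two

lemma measurable_timeIntegral {Ω : Type*} {W : ℝ → EuclideanSpace ℝ (Fin d) → Ω → ℝ} {s : ℝ}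
    (hs : 0 ≤ s) (η : ℝ) (y : EuclideanSpace ℝ (Fin d)) :
    Measurable[sigmaW W] (timeIntegral W η s y) :=
  ((measurable_sigmaW hs y).sub (measurable_sigmaW (le_max_right _ _) y)).const_mul _

lemma IsWeightedFracBrownianField.memLp_timeIntegral (hW : IsWeightedFracBrownianField H ρ W P)
    {s : ℝ} (hs : 0 ≤ s) (η : ℝ) (y : EuclideanSpace ℝ (Fin d)) :
    MemLp (timeIntegral W η s y) 2 P :=
  ((hW.memLp hs y).sub (hW.memLp (le_max_right _ _) y)).const_mul _

/-- The covariance of the field mollified in time. -/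
lemma IsWeightedFracBrownianField.integral_timeIntegral_mul
    (hW : IsWeightedFracBrownianField H ρ W P) {s s' : ℝ} (hs : 0 ≤ s) (hs' : 0 ≤ s')
    (η η' : ℝ) (y y' : EuclideanSpace ℝ (Fin d)) :
    ∫ ω, timeIntegral W η s y ω * timeIntegral W η' s' y' ω ∂P
      = timeKernel (H 0) η η' s s' * spaceCov H ρ y y' := by
  have ha : 0 ≤ max (s - η) 0 := le_max_right _ _
  have ha' : 0 ≤ max (s' - η') 0 := le_max_right _ _
  unfold timeIntegral timeKernel
  set a := max (s - η) 0
  set a' := max (s' - η') 0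
  have hi : ∀ r r', 0 ≤ r → 0 ≤ r' → Integrable (fun ω => W r y ω * W r' y' ω) P :=
    fun r r' hr hr' => (hW.memLp hr y).integrable_mul (hW.memLp hr' y')
  have h1 : ∀ ω, η⁻¹ * (W s y ω - W a y ω) * (η'⁻¹ * (W s' y' ω - W a' y' ω))
      = (η * η')⁻¹ * (W s y ω * W s' y' ω - W s y ω * W a' y' ω - W a y ω * W s' y' ω
        + W a y ω * W a' y' ω) := fun ω => by rw [mul_inv]; ring
  simp_rw [h1]
  have hi1 : Integrable (fun ω => W s y ω * W s' y' ω - W s y ω * W a' y' ω) P :=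
    (hi s s' hs hs').sub (hi s a' hs ha')
  have hi2 : Integrable
      (fun ω => W s y ω * W s' y' ω - W s y ω * W a' y' ω - W a y ω * W s' y' ω) P :=
    hi1.sub (hi a s' ha hs')
  rw [integral_const_mul, integral_add hi2 (hi a a' ha ha'), integral_sub hi1 (hi a s' ha hs'),
    integral_sub (hi s s' hs hs') (hi s a' hs ha'), hW.cov _ _ hs' hs,
    hW.cov _ _ ha' hs, hW.cov _ _ hs' ha, hW.cov _ _ ha' ha, fracCov_comm _ s' s,
    fracCov_comm _ a' s, fracCov_comm _ s' a, fracCov_comm _ a' a]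
  ring

lemma memLp_noiseDensity (hW : IsWeightedFracBrownianField H ρ W P)
    (hB : IsStdBrownianMotion T B P) {ε η s : ℝ} (hε : 0 < ε) (hs : s ∈ Icc 0 T)
    (y : EuclideanSpace ℝ (Fin d)) : MemLp (noiseDensity W B ε η s y) 2 P := by
  have hm : Measurable fun ω => heat ε (B s ω - y) :=
    (continuous_heat ε).measurable.comp ((hB.measurable s hs).sub_const y)
  exact memLp_bounded_mul hm (fun ω => by
    rw [abs_of_nonneg (heat_nonneg hε _)]; exact heat_le hε _) (hW.memLp_timeIntegral hs.1 η y)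

/-- Covariances of the noise density on events of the Brownian motion. -/
lemma inner_restrictL2_noiseDensity [IsProbabilityMeasure P]
    (hW : IsWeightedFracBrownianField H ρ W P)
    (hB : IsStdBrownianMotion T B P) (hBW : Indep (sigmaB T B) (sigmaW W) P)
    {ε ε' : ℝ} (hε : 0 < ε) (hε' : 0 < ε') (η η' : ℝ) {s s' : ℝ} (hs : s ∈ Icc 0 T)
    (hs' : s' ∈ Icc 0 T) (y y' : EuclideanSpace ℝ (Fin d)) {A : Set Ω}
    (hA : MeasurableSet[sigmaB T B] A) :
    inner ℝ (restrictL2 P A (toL2 P (noiseDensity W B ε η s y)))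
      (restrictL2 P A (toL2 P (noiseDensity W B ε' η' s' y')))
      = (∫ ω in A, heat ε (B s ω - y) * heat ε' (B s' ω - y') ∂P) *
        (timeKernel (H 0) η η' s s' * spaceCov H ρ y y') := by
  have hA' : MeasurableSet A := hB.sigmaB_le A hA
  rw [inner_restrictL2, ← hW.integral_timeIntegral_mul hs.1 hs'.1]
  have hYm : Measurable[sigmaB T B]
      (A.indicator fun ω => heat ε (B s ω - y) * heat ε' (B s' ω - y')) := by
    refine Measurable.indicator (Measurable.mul ?_ ?_) hA
    · exact (continuous_heat ε).measurable.comp ((measurable_sigmaB hs).sub_const y)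
    · exact (continuous_heat ε').measurable.comp ((measurable_sigmaB hs').sub_const y')
  have hUm : Measurable[sigmaW W]
      (fun ω => timeIntegral W η s y ω * timeIntegral W η' s' y' ω) :=
    (measurable_timeIntegral hs.1 η y).mul (measurable_timeIntegral hs'.1 η' y')
  have hI : IndepFun (A.indicator fun ω => heat ε (B s ω - y) * heat ε' (B s' ω - y'))
      (fun ω => timeIntegral W η s y ω * timeIntegral W η' s' y' ω) P :=
    (IndepFun_iff_Indep _ _ _).2
      (indep_of_indep_of_le_left (indep_of_indep_of_le_right hBW hUm.comap_le) hYm.comap_le)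
  have h1 := hI.integral_fun_mul_eq_mul_integral
    (hYm.mono hB.sigmaB_le le_rfl).aestronglyMeasurable
    (hUm.mono hW.sigmaW_le le_rfl).aestronglyMeasurable
  rw [integral_indicator hA'] at h1
  rw [← h1, ← integral_indicator hA']
  refine integral_congr_ae ?_
  filter_upwards [coeFn_toL2 (memLp_noiseDensity (η := η) hW hB hε hs y),
    coeFn_toL2 (memLp_noiseDensity (η := η') hW hB hε' hs' y')] with ω h2 h3
  by_cases h : ω ∈ A
  · rw [indicator_of_mem h, indicator_of_mem h, h2, h3, noiseDensity, noiseDensity]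
    ring
  · rw [indicator_of_notMem h, indicator_of_notMem h, zero_mul]

lemma inner_noiseDensity [IsProbabilityMeasure P]
    (hW : IsWeightedFracBrownianField H ρ W P)
    (hB : IsStdBrownianMotion T B P) (hBW : Indep (sigmaB T B) (sigmaW W) P)
    {ε : ℝ} (hε : 0 < ε) (η : ℝ) {s s' : ℝ} (hs : s ∈ Icc 0 T)
    (hs' : s' ∈ Icc 0 T) (y y' : EuclideanSpace ℝ (Fin d)) :
    inner ℝ (toL2 P (noiseDensity W B ε η s y)) (toL2 P (noiseDensity W B ε η s' y'))
      = (∫ ω, heat ε (B s ω - y) * heat ε (B s' ω - y') ∂P) *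
        (timeKernel (H 0) η η s s' * spaceCov H ρ y y') := by
  have h := inner_restrictL2_noiseDensity hW hB hBW hε hε η η hs hs' y y' (A := univ)
    (@MeasurableSet.univ _ (sigmaB T B))
  rw [inner_restrictL2, setIntegral_univ, setIntegral_univ] at h
  rw [← h, L2.inner_def]
  refine integral_congr_ae (Eventually.of_forall fun ω => ?_)
  simp only [RCLike.inner_apply, conj_trivial, mul_comm]

/-- The noise density is an `L²`-continuous function of time and space. -/
lemma continuousOn_noiseDensity [IsProbabilityMeasure P] (hH : ∀ i, H i ∈ Ioo (1 / 2 : ℝ) 1)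
    (hρ : Continuous ρ) (hW : IsWeightedFracBrownianField H ρ W P)
    (hB : IsStdBrownianMotion T B P) (hBW : Indep (sigmaB T B) (sigmaW W) P)
    {ε : ℝ} (hε : 0 < ε) (η : ℝ) :
    ContinuousOn (fun z : ℝ × EuclideanSpace ℝ (Fin d) => toL2 P (noiseDensity W B ε η z.1 z.2))
      (Icc 0 T ×ˢ univ) := by
  have hH0 : ∀ i, 0 < H i := fun i => by linarith [(hH i).1]
  refine continuousOn_of_continuousOn_inner ?_
  have hcont : ContinuousOn (fun p : (ℝ × EuclideanSpace ℝ (Fin d)) ×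
      (ℝ × EuclideanSpace ℝ (Fin d)) =>
      (∫ ω, heat ε (B p.1.1 ω - p.1.2) * heat ε (B p.2.1 ω - p.2.2) ∂P) *
        (timeKernel (H 0) η η p.1.1 p.2.1 * spaceCov H ρ p.1.2 p.2.2))
      ((Icc 0 T ×ˢ univ) ×ˢ (Icc 0 T ×ˢ univ)) := by
    refine ContinuousOn.mul ?_ (Continuous.continuousOn ?_)
    · refine continuousOn_of_dominated (bound := fun _ =>
        (2 * Real.pi * ε) ^ (-(d : ℝ) / 2) * (2 * Real.pi * ε) ^ (-(d : ℝ) / 2)) ?_ ?_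
        (integrable_const _) ?_
      · rintro p ⟨h1, h2⟩
        have h3 := hB.measurable _ h1.1
        have h4 := hB.measurable _ h2.1
        exact (((continuous_heat ε).measurable.comp (h3.sub_const _)).mul
          ((continuous_heat ε).measurable.comp (h4.sub_const _))).aestronglyMeasurable
      · refine fun p _ => Eventually.of_forall fun ω => ?_
        rw [norm_mul, Real.norm_of_nonneg (heat_nonneg hε _),
          Real.norm_of_nonneg (heat_nonneg hε _)]
        exact mul_le_mul (heat_le hε _) (heat_le hε _) (heat_nonneg hε _) (by positivity)
      · filter_upwards [hB.continuous_paths] with ω hω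
        refine ContinuousOn.mul ?_ ?_
        · exact (continuous_heat ε).comp_continuousOn
            ((hω.comp (by fun_prop) fun p hp => hp.1.1).sub (by fun_prop))
        · exact (continuous_heat ε).comp_continuousOn
            ((hω.comp (by fun_prop) fun p hp => hp.2.1).sub (by fun_prop))
    · exact ((continuous_timeKernel (hH0 0) η η).comp
        (by fun_prop : Continuous fun p : (ℝ × EuclideanSpace ℝ (Fin d)) ×
          (ℝ × EuclideanSpace ℝ (Fin d)) => (p.1.1, p.2.1))).mul
        ((continuous_spaceCov hH0 hρ).comp
        (by fun_prop : Continuous fun p : (ℝ × EuclideanSpace ℝ (Fin d)) ×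
          (ℝ × EuclideanSpace ℝ (Fin d)) => (p.1.2, p.2.2)))
  exact hcont.congr fun p hp =>
    inner_noiseDensity hW hB hBW hε η hp.1.1 hp.2.1 p.1.2 p.2.2

/-- The `L²` norm of the noise density has an integrable majorant in space, uniformly in time. -/
lemma exists_norm_noiseDensity_le [IsProbabilityMeasure P] (hH : ∀ i, H i ∈ Ioo (1 / 2 : ℝ) 1)
    {c : ℝ} (hc : ∀ x, |ρ x| ≤ c) (hW : IsWeightedFracBrownianField H ρ W P)
    (hB : IsStdBrownianMotion T B P) (hBW : Indep (sigmaB T B) (sigmaW W) P)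
    {ε : ℝ} (hε : 0 < ε) (η : ℝ) :
    ∃ C, ∀ s ∈ Icc 0 T, ∀ y : EuclideanSpace ℝ (Fin d),
      ‖toL2 P (noiseDensity W B ε η s y)‖ ≤ C * ((1 + ‖y‖) ^ (d + 1))⁻¹ := by
  obtain ⟨C, hC, h⟩ := exists_abs_heat_mul_spaceCov_le hH hc hε hε
  obtain ⟨M, hM, hmom⟩ := hB.exists_moment_mul_le (3 * d + 1)
  have hH0 : 0 < H 0 := by linarith [(hH 0).1]
  have hdiag : Continuous fun s : ℝ => (s, s) := by fun_prop
  have hKc := (continuous_timeKernel hH0 η η).comp hdiag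
  simp only [Function.comp_def] at hKc
  obtain ⟨K, hK⟩ := (isCompact_Icc (a := (0 : ℝ)) (b := T)).exists_bound_of_continuousOn
    hKc.continuousOn
  refine ⟨√(C * M * K), fun s hs y => ?_⟩
  have hg : 0 ≤ ((1 + ‖y‖) ^ (d + 1))⁻¹ := by positivity
  have hK0 : 0 ≤ K := (norm_nonneg _).trans (hK s hs)
  obtain ⟨hi, hi'⟩ := hmom s hs s hs
  have h1 : |∫ ω, heat ε (B s ω - y) * heat ε (B s ω - y) * spaceCov H ρ y y ∂P|
      ≤ C * M * (((1 + ‖y‖) ^ (d + 1))⁻¹ * ((1 + ‖y‖) ^ (d + 1))⁻¹) := by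
    refine (norm_integral_le_of_norm_le (f := fun ω => heat ε (B s ω - y) * heat ε (B s ω - y) *
      spaceCov H ρ y y) ((hi.const_mul C).mul_const
      (((1 + ‖y‖) ^ (d + 1))⁻¹ * ((1 + ‖y‖) ^ (d + 1))⁻¹))
      (Eventually.of_forall fun ω => h (B s ω) (B s ω) y y)).trans ?_
    rw [integral_mul_const, integral_const_mul]
    gcongr
  have h2 : ‖toL2 P (noiseDensity W B ε η s y)‖ ^ 2
      ≤ C * M * K * ((1 + ‖y‖) ^ (d + 1))⁻¹ ^ 2 := by
    rw [← real_inner_self_eq_norm_sq, inner_noiseDensity hW hB hBW hε η hs hs y y]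
    rw [integral_mul_const] at h1
    calc _ ≤ |timeKernel (H 0) η η s s| *
          |(∫ ω, heat ε (B s ω - y) * heat ε (B s ω - y) ∂P) * spaceCov H ρ y y| := by
          rw [← abs_mul]
          exact (le_abs_self _).trans_eq (by congr 1; ring)
      _ ≤ K * (C * M * (((1 + ‖y‖) ^ (d + 1))⁻¹ * ((1 + ‖y‖) ^ (d + 1))⁻¹)) :=
          mul_le_mul (hK s hs) h1 (abs_nonneg _) hK0
      _ = _ := by ring
  have h3 := Real.sqrt_le_sqrt h2
  rwa [Real.sqrt_sq (norm_nonneg _), Real.sqrt_mul (by positivity), Real.sqrt_sq hg] at h3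

end

/-! ### Covariances of the regularized stochastic integrals -/

section

variable {Ω : Type*} [mΩ : MeasurableSpace Ω] {P : Measure Ω} [IsProbabilityMeasure P]
  {d : ℕ} {T : ℝ} {H : Fin (d + 1) → ℝ} {ρ : EuclideanSpace ℝ (Fin d) → ℝ}
  {W : ℝ → EuclideanSpace ℝ (Fin d) → Ω → ℝ} {B : ℝ → Ω → EuclideanSpace ℝ (Fin d)}

lemma integrable_noiseDensity (hH : ∀ i, H i ∈ Ioo (1 / 2 : ℝ) 1) (hρ : Continuous ρ)
    {c : ℝ} (hc : ∀ x, |ρ x| ≤ c) (hW : IsWeightedFracBrownianField H ρ W P)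
    (hB : IsStdBrownianMotion T B P) (hBW : Indep (sigmaB T B) (sigmaW W) P)
    {ε : ℝ} (hε : 0 < ε) (η : ℝ) {s : ℝ} (hs : s ∈ Icc 0 T) :
    Integrable fun y => toL2 P (noiseDensity W B ε η s y) := by
  obtain ⟨C, hC⟩ := exists_norm_noiseDensity_le hH hc hW hB hBW hε η
  refine (integrable_inv_one_add_norm_pow.const_mul C).mono' ?_
    (Eventually.of_forall fun y => hC s hs y)
  have h0 : Continuous fun y : EuclideanSpace ℝ (Fin d) => (s, y) := by fun_prop
  have h1 := (continuousOn_noiseDensity hH hρ hW hB hBW hε η).comp_continuous h0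
    fun y => ⟨hs, mem_univ _⟩
  exact h1.aestronglyMeasurable

lemma integrableOn_regNoise (hH : ∀ i, H i ∈ Ioo (1 / 2 : ℝ) 1) (hρ : Continuous ρ)
    {c : ℝ} (hc : ∀ x, |ρ x| ≤ c) (hW : IsWeightedFracBrownianField H ρ W P)
    (hB : IsStdBrownianMotion T B P) (hBW : Indep (sigmaB T B) (sigmaW W) P)
    {ε : ℝ} (hε : 0 < ε) (η : ℝ) :
    IntegrableOn (fun s => regNoise P W B ε η s) (Icc 0 T) := by
  obtain ⟨C, hC⟩ := exists_norm_noiseDensity_le hH hc hW hB hBW hε η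
  have h1 : AEStronglyMeasurable (fun z : ℝ × EuclideanSpace ℝ (Fin d) =>
      toL2 P (noiseDensity W B ε η z.1 z.2)) ((volume.restrict (Icc 0 T)).prod volume) := by
    have h2 := (continuousOn_noiseDensity hH hρ hW hB hBW hε η).aestronglyMeasurable
      (μ := volume) (measurableSet_Icc.prod MeasurableSet.univ)
    rwa [Measure.volume_eq_prod, ← Measure.prod_restrict, Measure.restrict_univ] at h2
  refine Integrable.of_bound (h1.integral_prod_right' (f := fun z => _))
    (∫ y : EuclideanSpace ℝ (Fin d), C * ((1 + ‖y‖) ^ (d + 1))⁻¹) ?_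
  filter_upwards [ae_restrict_mem measurableSet_Icc] with s hs
  exact norm_integral_le_of_norm_le (integrable_inv_one_add_norm_pow.const_mul C)
    (Eventually.of_forall fun y => hC s hs y)

/-- Covariances of the regularized noise on events of the Brownian motion. -/
lemma inner_restrictL2_regNoise (hH : ∀ i, H i ∈ Ioo (1 / 2 : ℝ) 1) (hρ : Continuous ρ)
    {c : ℝ} (hc : ∀ x, |ρ x| ≤ c) (hW : IsWeightedFracBrownianField H ρ W P)
    (hB : IsStdBrownianMotion T B P) (hBW : Indep (sigmaB T B) (sigmaW W) P)
    {ε ε' : ℝ} (hε : 0 < ε) (hε' : 0 < ε') (η η' : ℝ) {s s' : ℝ} (hs : s ∈ Icc 0 T)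
    (hs' : s' ∈ Icc 0 T) {A : Set Ω} (hA : MeasurableSet[sigmaB T B] A) :
    inner ℝ (restrictL2 P A (regNoise P W B ε η s)) (restrictL2 P A (regNoise P W B ε' η' s'))
      = timeKernel (H 0) η η' s s' * ∫ ω in A, mollCov H ρ ε ε' (B s ω) (B s' ω) ∂P := by
  have hi := integrable_noiseDensity hH hρ hc hW hB hBW hε η hs
  have hi' := integrable_noiseDensity hH hρ hc hW hB hBW hε' η' hs'
  unfold regNoise
  rw [← (restrictL2 P A).integral_comp_comm hi, ← (restrictL2 P A).integral_comp_comm hi',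
    (inner_integral_integral ((restrictL2 P A).integrable_comp hi)
      ((restrictL2 P A).integrable_comp hi')).2]
  simp_rw [inner_restrictL2_noiseDensity hW hB hBW hε hε' η η' hs hs' _ _ hA]
  simp_rw [mul_left_comm _ (timeKernel (H 0) η η' s s'), ← integral_mul_const]
  rw [integral_const_mul, ← Measure.volume_eq_prod]
  congr 1
  unfold mollCov
  refine integral_integral_swap (μ := volume) (ν := P.restrict A)
    (f := fun (z : EuclideanSpace ℝ (Fin d) × EuclideanSpace ℝ (Fin d)) ω =>
      heat ε (B s ω - z.1) * heat ε' (B s' ω - z.2) * spaceCov H ρ z.1 z.2) ?_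
  obtain ⟨C, hC, h⟩ := exists_abs_heat_mul_spaceCov_le hH hc hε hε'
  obtain ⟨M, hM, hmom⟩ := hB.exists_moment_mul_le (3 * d + 1)
  have hBs := hB.measurable s hs
  have hBs' := hB.measurable s' hs'
  have hmaj := ((integrable_inv_one_add_norm_pow (d := d)).mul_prod
    (integrable_inv_one_add_norm_pow (d := d))).mul_prod
      (((hmom s hs s' hs').1.const_mul C).restrict (s := A))
  refine hmaj.mono' ?_ (Eventually.of_forall fun z => ?_)
  · refine Measurable.aestronglyMeasurable (Measurable.mul (Measurable.mul ?_ ?_) ?_)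
    · exact (continuous_heat ε).measurable.comp
        ((hBs.comp measurable_snd).sub (measurable_fst.comp measurable_fst))
    · exact (continuous_heat ε').measurable.comp
        ((hBs'.comp measurable_snd).sub (measurable_snd.comp measurable_fst))
    · exact (continuous_spaceCov (fun i => by linarith [(hH i).1]) hρ).measurable.comp
        measurable_fst
  · refine (h (B s z.2) (B s' z.2) z.1.1 z.1.2).trans_eq ?_
    ring

/-- Covariances of the regularized stochastic integrals on events of the Brownian motion. -/
lemma inner_restrictL2_regIntegral (hH : ∀ i, H i ∈ Ioo (1 / 2 : ℝ) 1) (hρ : Continuous ρ)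
    {c : ℝ} (hc : ∀ x, |ρ x| ≤ c) (hW : IsWeightedFracBrownianField H ρ W P)
    (hB : IsStdBrownianMotion T B P) (hBW : Indep (sigmaB T B) (sigmaW W) P)
    {ε ε' : ℝ} (hε : 0 < ε) (hε' : 0 < ε') (η η' : ℝ) {t : ℝ} (ht : t ∈ Icc 0 T)
    {A : Set Ω} (hA : MeasurableSet[sigmaB T B] A) :
    AEStronglyMeasurable (fun p : ℝ × ℝ => timeKernel (H 0) η η' p.1 p.2 *
        ∫ ω in A, mollCov H ρ ε ε' (B p.1 ω) (B p.2 ω) ∂P)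
      (volume.restrict (Icc t T ×ˢ Icc t T)) ∧
    inner ℝ (restrictL2 P A (regIntegral P W B T t ε η))
        (restrictL2 P A (regIntegral P W B T t ε' η'))
      = ∫ p in Icc t T ×ˢ Icc t T, timeKernel (H 0) η η' p.1 p.2 *
        ∫ ω in A, mollCov H ρ ε ε' (B p.1 ω) (B p.2 ω) ∂P := by
  have hsub : Icc t T ⊆ Icc 0 T := Icc_subset_Icc_left ht.1
  have hi := (integrableOn_regNoise hH hρ hc hW hB hBW hε η).mono_set hsub
  have hi' := (integrableOn_regNoise hH hρ hc hW hB hBW hε' η').mono_set hsub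
  obtain ⟨h1, h2⟩ := inner_integral_integral ((restrictL2 P A).integrable_comp hi)
    ((restrictL2 P A).integrable_comp hi')
  have hae : (fun p : ℝ × ℝ => inner ℝ (restrictL2 P A (regNoise P W B ε η p.1))
      (restrictL2 P A (regNoise P W B ε' η' p.2))) =ᵐ[volume.restrict (Icc t T ×ˢ Icc t T)]
      fun p => timeKernel (H 0) η η' p.1 p.2 *
        ∫ ω in A, mollCov H ρ ε ε' (B p.1 ω) (B p.2 ω) ∂P := by
    filter_upwards [ae_restrict_mem (measurableSet_Icc.prod measurableSet_Icc)] with p hp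
    exact inner_restrictL2_regNoise hH hρ hc hW hB hBW hε hε' η η' (hsub hp.1) (hsub hp.2) hA
  rw [Measure.prod_restrict, ← Measure.volume_eq_prod] at h1 h2
  refine ⟨h1.aestronglyMeasurable.congr hae, ?_⟩
  unfold regIntegral
  rw [intervalIntegral.integral_of_le ht.2, intervalIntegral.integral_of_le ht.2,
    ← integral_Icc_eq_integral_Ioc, ← integral_Icc_eq_integral_Ioc,
    ← (restrictL2 P A).integral_comp_comm hi, ← (restrictL2 P A).integral_comp_comm hi', h2]
  exact integral_congr_ae hae

lemma measurable_mollCov {Ω : Type*} [MeasurableSpace Ω] (hH : ∀ i, H i ∈ Ioo (1 / 2 : ℝ) 1)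
    (hρ : Continuous ρ) {X Y : Ω → EuclideanSpace ℝ (Fin d)} (hX : Measurable X)
    (hY : Measurable Y) (ε ε' : ℝ) : Measurable fun ω => mollCov H ρ ε ε' (X ω) (Y ω) := by
  unfold mollCov
  refine (Measurable.stronglyMeasurable ?_).integral_prod_right'
    (f := fun q : Ω × (EuclideanSpace ℝ (Fin d) × EuclideanSpace ℝ (Fin d)) =>
      heat ε (X q.1 - q.2.1) * heat ε' (Y q.1 - q.2.2) * spaceCov H ρ q.2.1 q.2.2) |>.measurable
  refine Measurable.mul (Measurable.mul ?_ ?_) ?_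
  · exact (continuous_heat ε).measurable.comp
      ((hX.comp measurable_fst).sub (measurable_fst.comp measurable_snd))
  · exact (continuous_heat ε').measurable.comp
      ((hY.comp measurable_fst).sub (measurable_snd.comp measurable_snd))
  · exact (continuous_spaceCov (fun i => by linarith [(hH i).1]) hρ).measurable.comp
      measurable_snd

lemma ae_fst_ne_snd : ∀ᵐ p : ℝ × ℝ, p.1 ≠ p.2 := by
  rw [Measure.volume_eq_prod, Measure.ae_prod_iff_ae_ae]
  · refine Eventually.of_forall fun x => ?_
    have := (measure_singleton x : volume ({x} : Set ℝ) = 0)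
    filter_upwards [compl_mem_ae_iff.2 this] with y hy h
    exact hy (by rw [← h]; rfl)
  · exact (measurableSet_eq_fun measurable_fst measurable_snd).compl

lemma ae_fst_snd_ne_zero : ∀ᵐ p : ℝ × ℝ, p.1 ≠ 0 ∧ p.2 ≠ 0 := by
  have h0 : ∀ᵐ x : ℝ, x ≠ 0 := compl_mem_ae_iff.2 (measure_singleton 0)
  rw [Measure.volume_eq_prod]
  exact (Measure.quasiMeasurePreserving_fst.ae h0).and (Measure.quasiMeasurePreserving_snd.ae h0)

/-- The covariances of the regularized stochastic integrals on an event `A` of the Brownian motion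
converge to the integral over `A` of the conditional variance. -/
lemma tendsto_inner_restrictL2_regIntegral (hH : ∀ i, H i ∈ Ioo (1 / 2 : ℝ) 1)
    (hρ : Continuous ρ) {c : ℝ} (hc : ∀ x, |ρ x| ≤ c) (hW : IsWeightedFracBrownianField H ρ W P)
    (hB : IsStdBrownianMotion T B P) (hBW : Indep (sigmaB T B) (sigmaW W) P) {t : ℝ}
    (ht : t ∈ Icc 0 T) {A : Set Ω} (hA : MeasurableSet[sigmaB T B] A) :
    Tendsto (fun q : (ℝ × ℝ) × (ℝ × ℝ) =>
        inner ℝ (restrictL2 P A (regIntegral P W B T t q.1.1 q.1.2))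
          (restrictL2 P A (regIntegral P W B T t q.2.1 q.2.2)))
      ((𝓝[>] (0 : ℝ) ×ˢ 𝓝[>] (0 : ℝ)) ×ˢ (𝓝[>] (0 : ℝ) ×ˢ 𝓝[>] (0 : ℝ)))
      (𝓝 (∫ ω in A, variance H ρ B T t ω ∂P)) := by
  set l : Filter ((ℝ × ℝ) × (ℝ × ℝ)) :=
    (𝓝[>] (0 : ℝ) ×ˢ 𝓝[>] (0 : ℝ)) ×ˢ (𝓝[>] (0 : ℝ) ×ˢ 𝓝[>] (0 : ℝ)) with hl
  have hA' : MeasurableSet A := hB.sigmaB_le A hA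
  have hsmall1 : ∀ᶠ ε : ℝ in 𝓝[>] (0 : ℝ), 0 < ε ∧ ε ≤ 1 :=
    Filter.Eventually.and self_mem_nhdsWithin (nhdsWithin_le_nhds (Iic_mem_nhds one_pos))
  have hsmall : ∀ᶠ q in l, ((0 < q.1.1 ∧ q.1.1 ≤ 1) ∧ (0 < q.1.2 ∧ q.1.2 ≤ 1)) ∧
      ((0 < q.2.1 ∧ q.2.1 ≤ 1) ∧ (0 < q.2.2 ∧ q.2.2 ≤ 1)) :=
    (hsmall1.prod_mk hsmall1).prod_mk (hsmall1.prod_mk hsmall1)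
  have hεl : Tendsto (fun q : (ℝ × ℝ) × (ℝ × ℝ) => (q.1.1, q.2.1)) l
      (𝓝[>] (0 : ℝ) ×ˢ 𝓝[>] (0 : ℝ)) :=
    (tendsto_fst.comp tendsto_fst).prodMk (tendsto_fst.comp tendsto_snd)
  have hηl : Tendsto (fun q : (ℝ × ℝ) × (ℝ × ℝ) => (q.1.2, q.2.2)) l
      (𝓝[>] (0 : ℝ) ×ˢ 𝓝[>] (0 : ℝ)) :=
    (tendsto_snd.comp tendsto_fst).prodMk (tendsto_snd.comp tendsto_snd)
  obtain ⟨C, hC, hmoll⟩ := exists_abs_mollCov_le hH hρ hc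
  obtain ⟨M, hM, hmom⟩ := hB.exists_moment_mul_le (2 * d)
  have hsub : Icc t T ⊆ Icc 0 T := Icc_subset_Icc_left ht.1
  have hbound : ∀ q : (ℝ × ℝ) × (ℝ × ℝ), ((0 < q.1.1 ∧ q.1.1 ≤ 1) ∧ (0 < q.1.2 ∧ q.1.2 ≤ 1)) ∧
      ((0 < q.2.1 ∧ q.2.1 ≤ 1) ∧ (0 < q.2.2 ∧ q.2.2 ≤ 1)) → ∀ p : ℝ × ℝ, p.1 ∈ Icc 0 T →
      p.2 ∈ Icc 0 T → ‖∫ ω in A, mollCov H ρ q.1.1 q.2.1 (B p.1 ω) (B p.2 ω) ∂P‖ ≤ C * M := by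
    intro q hq p hp1 hp2
    obtain ⟨h1, h2⟩ := hmom _ hp1 _ hp2
    refine (norm_integral_le_of_norm_le (h1.const_mul C).integrableOn (Eventually.of_forall
      fun ω => hmoll q.1.1 q.2.1 hq.1.1.1 hq.1.1.2 hq.2.1.1 hq.2.1.2 _ _)).trans ?_
    refine (setIntegral_le_integral (h1.const_mul C) (Eventually.of_forall fun ω => ?_)).trans ?_
    · simp only [Pi.zero_apply]; positivity
    · rw [integral_const_mul]
      gcongr
  rw [(hB.variance_properties hH hρ hc ht).2.2.2 A hA']
  have hlim : Tendsto (fun q : (ℝ × ℝ) × (ℝ × ℝ) => ∫ p in Icc t T ×ˢ Icc t T,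
      timeKernel (H 0) q.1.2 q.2.2 p.1 p.2 *
        ∫ ω in A, mollCov H ρ q.1.1 q.2.1 (B p.1 ω) (B p.2 ω) ∂P) l
      (𝓝 (∫ p in Icc t T ×ˢ Icc t T, alphaH (H 0) * |p.1 - p.2| ^ (2 * H 0 - 2) *
        ∫ ω in A, spaceCov H ρ (B p.1 ω) (B p.2 ω) ∂P)) := by
    refine tendsto_integral_filter_of_dominated_convergence
      (fun p => 4 * (2 * H 0) / (2 * H 0 - 1) * (C * M) * |p.1 - p.2| ^ (2 * H 0 - 2)) ?_ ?_
      ((integrableOn_abs_sub_rpow (by linarith [(hH 0).1]) t T).const_mul _) ?_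
    · filter_upwards [hsmall] with q hq
      exact (inner_restrictL2_regIntegral hH hρ hc hW hB hBW hq.1.1.1 hq.2.1.1 _ _ ht hA).1
    · filter_upwards [hsmall] with q hq
      have hdiag : ∀ᵐ p : ℝ × ℝ ∂volume.restrict (Icc t T ×ˢ Icc t T), p.1 ≠ p.2 :=
        ae_restrict_of_ae ae_fst_ne_snd
      filter_upwards [hdiag, ae_restrict_mem (measurableSet_Icc.prod measurableSet_Icc)]
        with p hne hp
      have hp1 : p.1 ∈ Icc 0 T := hsub hp.1
      have hp2 : p.2 ∈ Icc 0 T := hsub hp.2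
      have hb := hbound q hq p hp1 hp2
      rw [norm_mul]
      calc _ ≤ (4 * (2 * H 0) / (2 * H 0 - 1) * |p.1 - p.2| ^ (2 * H 0 - 2)) * (C * M) :=
            mul_le_mul (abs_timeKernel_le (hH 0) hq.1.2.1 hq.2.2.1 hp1.1 hp2.1 hne) hb
              (norm_nonneg _) (mul_nonneg (div_nonneg (by linarith [(hH 0).1])
                (by linarith [(hH 0).1])) (by positivity))
        _ = _ := by ring
    · have hdiag : ∀ᵐ p : ℝ × ℝ ∂volume.restrict (Icc t T ×ˢ Icc t T), p.1 ≠ p.2 :=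
        ae_restrict_of_ae ae_fst_ne_snd
      have hzero : ∀ᵐ p : ℝ × ℝ ∂volume.restrict (Icc t T ×ˢ Icc t T), p.1 ≠ 0 ∧ p.2 ≠ 0 :=
        ae_restrict_of_ae ae_fst_snd_ne_zero
      filter_upwards [hdiag, hzero, ae_restrict_mem (measurableSet_Icc.prod measurableSet_Icc)]
        with p hne h0 hp
      have hp1 : p.1 ∈ Icc 0 T := hsub hp.1
      have hp2 : p.2 ∈ Icc 0 T := hsub hp.2
      refine Tendsto.mul ((tendsto_timeKernel (hH 0).1 (hp1.1.lt_of_ne h0.1.symm)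
        (hp2.1.lt_of_ne h0.2.symm) hne).comp hηl) ?_
      refine tendsto_integral_filter_of_dominated_convergence
        (fun ω => C * ((1 + ‖B p.1 ω‖) ^ (2 * d) * (1 + ‖B p.2 ω‖) ^ (2 * d))) ?_ ?_
        ((hmom _ hp1 _ hp2).1.const_mul C).integrableOn (Eventually.of_forall fun ω => ?_)
      · filter_upwards [hsmall] with q hq
        exact (measurable_mollCov hH hρ (hB.measurable _ hp1) (hB.measurable _ hp2)
          q.1.1 q.2.1).aestronglyMeasurable
      · filter_upwards [hsmall] with q hq
        exact Eventually.of_forall fun ω =>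
          hmoll q.1.1 q.2.1 hq.1.1.1 hq.1.1.2 hq.2.1.1 hq.2.1.2 _ _
      · exact (tendsto_mollCov hH hρ hc (B p.1 ω) (B p.2 ω)).comp hεl
  refine hlim.congr' ?_
  filter_upwards [hsmall] with q hq
  exact (inner_restrictL2_regIntegral hH hρ hc hW hB hBW hq.1.1.1 hq.2.1.1 _ _ ht hA).2.symm

end

/-! ### The limit and its conditional law -/

section

/-- A family in a Hilbert space converges as soon as its inner products do. -/
lemma exists_tendsto_of_tendsto_inner {X E : Type*} [NormedAddCommGroup E]
    [InnerProductSpace ℝ E] [CompleteSpace E] {l : Filter X} [l.NeBot] {f : X → E} {I : ℝ}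
    (h : Tendsto (fun q : X × X => inner ℝ (f q.1) (f q.2)) (l ×ˢ l) (𝓝 I)) :
    ∃ V, Tendsto f l (𝓝 V) := by
  refine cauchy_map_iff_exists_tendsto.1 (cauchy_map_iff.2 ⟨inferInstance, ?_⟩)
  rw [tendsto_uniformity_iff_dist_tendsto_zero]
  have h1 : Tendsto (fun q : X × X => inner ℝ (f q.1) (f q.1)) (l ×ˢ l) (𝓝 I) :=
    h.comp (tendsto_fst.prodMk tendsto_fst)
  have h2 : Tendsto (fun q : X × X => inner ℝ (f q.2) (f q.2)) (l ×ˢ l) (𝓝 I) :=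
    h.comp (tendsto_snd.prodMk tendsto_snd)
  have h3 := ((h1.sub (h.const_mul 2)).add h2).sqrt
  rw [show I - 2 * I + I = 0 by ring, Real.sqrt_zero] at h3
  refine h3.congr fun q => ?_
  rw [real_inner_self_eq_norm_sq, real_inner_self_eq_norm_sq, ← norm_sub_sq_real,
    Real.sqrt_sq (norm_nonneg _), dist_eq_norm]

variable {Ω : Type*} [mΩ : MeasurableSpace Ω] {P : Measure Ω} {d : ℕ} {T : ℝ}
  {H : Fin (d + 1) → ℝ} {ρ : EuclideanSpace ℝ (Fin d) → ℝ}
  {W : ℝ → EuclideanSpace ℝ (Fin d) → Ω → ℝ} {B : ℝ → Ω → EuclideanSpace ℝ (Fin d)}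

lemma regIntegral_mem_closedSpan (hW : IsWeightedFracBrownianField H ρ W P)
    (hB : IsStdBrownianMotion T B P) {ε η t : ℝ} (hε : 0 < ε) (ht : t ∈ Icc 0 T) :
    regIntegral P W B T t ε η ∈ closedSpan (sigmaB T B) P
      (fun p : Set.Ici (0 : ℝ) × EuclideanSpace ℝ (Fin d) => W p.1 p.2) := by
  have hclosed : IsClosed ((closedSpan (sigmaB T B) P
      (fun p : Set.Ici (0 : ℝ) × EuclideanSpace ℝ (Fin d) => W p.1 p.2) :
        Submodule ℝ (Lp ℝ 2 P)) : Set (Lp ℝ 2 P)) := Submodule.isClosed_topologicalClosure _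
  unfold regIntegral
  rw [intervalIntegral.integral_of_le ht.2]
  refine integral_mem_of_forall_mem hclosed ?_
  filter_upwards [ae_restrict_mem measurableSet_Ioc] with s hs
  have hs' : s ∈ Icc 0 T := ⟨ht.1.trans hs.1.le, hs.2⟩
  refine integral_mem_of_forall_mem hclosed (Eventually.of_forall fun y => ?_)
  have hZ : Measurable[sigmaB T B] fun ω => η⁻¹ * heat ε (B s ω - y) :=
    ((continuous_heat ε).measurable.comp ((measurable_sigmaB hs').sub_const y)).const_mul _
  have hZb : ∀ ω, |η⁻¹ * heat ε (B s ω - y)|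
      ≤ |η⁻¹| * (2 * Real.pi * ε) ^ (-(d : ℝ) / 2) := fun ω => by
    rw [abs_mul, abs_of_nonneg (heat_nonneg hε _)]
    exact mul_le_mul_of_nonneg_left (heat_le hε _) (abs_nonneg _)
  have h1 := toL2_mul_mem_closedSpan (P := P)
    (fun p : Set.Ici (0 : ℝ) × EuclideanSpace ℝ (Fin d) => W p.1 p.2) hZ hZb (⟨s, hs'.1⟩, y)
  have h2 := toL2_mul_mem_closedSpan (P := P)
    (fun p : Set.Ici (0 : ℝ) × EuclideanSpace ℝ (Fin d) => W p.1 p.2) hZ hZb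
    (⟨max (s - η) 0, mem_Ici.2 (le_max_right _ _)⟩, y)
  have hm1 := memLp_bounded_mul (hZ.mono hB.sigmaB_le le_rfl) hZb (hW.memLp hs'.1 y)
  have hm2 := memLp_bounded_mul (hZ.mono hB.sigmaB_le le_rfl) hZb
    (hW.memLp (le_max_right (s - η) 0) y)
  have heq : toL2 P (noiseDensity W B ε η s y)
      = toL2 P (fun ω => η⁻¹ * heat ε (B s ω - y) * W s y ω)
        - toL2 P (fun ω => η⁻¹ * heat ε (B s ω - y) * W (max (s - η) 0) y ω) := by
    refine Lp.ext ?_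
    filter_upwards [coeFn_toL2 (memLp_noiseDensity (η := η) hW hB hε hs' y), coeFn_toL2 hm1,
      coeFn_toL2 hm2, Lp.coeFn_sub (toL2 P (fun ω => η⁻¹ * heat ε (B s ω - y) * W s y ω))
        (toL2 P (fun ω => η⁻¹ * heat ε (B s ω - y) * W (max (s - η) 0) y ω))] with ω e1 e2 e3 e4
    rw [e1, e4, Pi.sub_apply, e2, e3, noiseDensity, timeIntegral]
    ring
  rw [heq]
  exact Submodule.sub_mem _ h1 h2

end

end FracNoise

open FracNoise in
theorem proposition2p1 {Ω : Type*} [MeasurableSpace Ω] (P : Measure Ω) [IsProbabilityMeasure P]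
    (d : ℕ) (T : ℝ) (hT : 0 < T)
    (H : Fin (d + 1) → ℝ) (hH : ∀ i, H i ∈ Set.Ioo (1 / 2 : ℝ) 1)
    (ρ : EuclideanSpace ℝ (Fin d) → ℝ) (hρ : Continuous ρ)
    (β : Fin d → ℝ) (hβ : ∀ i, β i ∈ Set.Ioo (0 : ℝ) 2) (hβH : ∀ i : Fin d, β i < 2 * H i.succ)
    (hdecay : FracNoise.PowerDecay ρ β)
    (hα : ∑ i : Fin d, (2 * H i.succ - β i) < 2)
    (W : ℝ → EuclideanSpace ℝ (Fin d) → Ω → ℝ)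
    (hW : FracNoise.IsWeightedFracBrownianField H ρ W P)
    (B : ℝ → Ω → EuclideanSpace ℝ (Fin d)) (hB : FracNoise.IsStdBrownianMotion T B P)
    (hBW : Indep (FracNoise.sigmaB T B) (FracNoise.sigmaW W) P)
    (t : ℝ) (ht : t ∈ Set.Icc 0 T) :
    -- the approximations are well defined
    (∀ ε η : ℝ, 0 < ε → 0 < η →
      (∀ s ∈ Set.Icc 0 T,
        (∀ y, MemLp (FracNoise.noiseDensity W B ε η s y) 2 P) ∧
        Integrable (fun y => FracNoise.toL2 P (FracNoise.noiseDensity W B ε η s y)) volume) ∧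
      IntervalIntegrable (fun s => FracNoise.regNoise P W B ε η s) volume t T) ∧
    -- the limit exists, is conditionally Gaussian and has the stated conditional variance
    (∀ᵐ ω ∂P, IntegrableOn
      (fun p : ℝ × ℝ => FracNoise.varDensity H ρ (fun r => B r ω) p.1 p.2)
      (Set.Icc t T ×ˢ Set.Icc t T) volume) ∧
    ∃ V : Lp ℝ 2 P,
      Tendsto (fun p : ℝ × ℝ => FracNoise.regIntegral P W B T t p.1 p.2)
        (𝓝[>] (0 : ℝ) ×ˢ 𝓝[>] (0 : ℝ)) (𝓝 V) ∧
      FracNoise.IsCondCenteredGaussian P (FracNoise.sigmaB T B) V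
        (FracNoise.variance H ρ B T t) ∧
      condVar (FracNoise.sigmaB T B) V P =ᵐ[P] FracNoise.variance H ρ B T t := by
  obtain ⟨c, -, hc⟩ := hdecay.exists_abs_le fun i => (hβ i).1.le
  have hm := hB.sigmaB_le
  obtain ⟨hint, hvi, hvm, -⟩ := hB.variance_properties hH hρ hc ht
  have hlim := fun (A : Set Ω) (hA : MeasurableSet[sigmaB T B] A) =>
    tendsto_inner_restrictL2_regIntegral hH hρ hc hW hB hBW ht hA
  obtain ⟨V, hV⟩ : ∃ V, Tendsto (fun p : ℝ × ℝ => regIntegral P W B T t p.1 p.2)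
      (𝓝[>] (0 : ℝ) ×ˢ 𝓝[>] (0 : ℝ)) (𝓝 V) := by
    refine exists_tendsto_of_tendsto_inner
      ((hlim univ (@MeasurableSet.univ _ (sigmaB T B))).congr fun q => ?_)
    rw [inner_restrictL2, setIntegral_univ, L2.inner_def]
    refine integral_congr_ae (Eventually.of_forall fun ω => ?_)
    simp only [RCLike.inner_apply, conj_trivial, mul_comm]
  have hcond : variance H ρ B T t =ᵐ[P] P[fun ω => V ω ^ 2 | sigmaB T B] := by
    refine ae_eq_condExp_of_forall_setIntegral_eq hm (Lp.memLp V).integrable_sq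
      (fun A _ _ => hvi.integrableOn) (fun A hA _ => ?_) hvm
    have h1 : Tendsto (fun p : ℝ × ℝ => restrictL2 P A (regIntegral P W B T t p.1 p.2))
        (𝓝[>] (0 : ℝ) ×ˢ 𝓝[>] (0 : ℝ)) (𝓝 (restrictL2 P A V)) :=
      ((restrictL2 P A).continuous.tendsto V).comp hV
    have h2 := tendsto_nhds_unique ((hlim A hA).comp (tendsto_id.prodMk tendsto_id))
      (h1.inner h1)
    rw [h2, inner_restrictL2]
    simp only [sq]
  have hG : CondGaussian (sigmaB T B) V := by
    refine condGaussian_of_mem_closedSpan hm hW.sigmaW_le hBW hW.gaussian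
      (fun p => measurable_sigmaW p.1.2 p.2) (fun p => hW.mean p.1 p.1.2 p.2) ?_
    refine (Submodule.isClosed_topologicalClosure _).mem_of_tendsto hV ?_
    have hpos : ∀ᶠ ε : ℝ in 𝓝[>] (0 : ℝ), 0 < ε := self_mem_nhdsWithin
    filter_upwards [tendsto_fst.eventually hpos] with p hp
    exact regIntegral_mem_closedSpan hW hB hp ht
  refine ⟨fun ε η hε _ => ⟨fun s hs => ⟨fun y => memLp_noiseDensity hW hB hε hs y,
    integrable_noiseDensity hH hρ hc hW hB hBW hε η hs⟩, ?_⟩, hint, V, hV,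
    hG.isCondCenteredGaussian hm hcond, (hG.condVar_ae_eq hm).trans hcond.symm⟩
  rw [intervalIntegrable_iff_integrableOn_Icc_of_le ht.2]
  exact (integrableOn_regNoise hH hρ hc hW hB hBW hε η).mono_set (Icc_subset_Icc_left ht.1)
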